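/- Throughout, all quantum systems are finite-dimensional. For a system $X$ let $\mathfrak B(X)$ be the algebra of operators on $X$, $\mathfrak S(X)$ the set of states (density matrices), $\mathfrak U(X)$ the unitary group, $\mathfrak L(X,Y)$ the space of linear maps $\mathfrak B(X)\to\mathfrak B(Y)$, and $\mathfrak C(X,Y)\subseteq\mathfrak L(X,Y)$ the set of quantum channels (completely positive trace-preserving maps); $\mathrm{Ad}_M(K)=MKM^\dagger$. A superchannel on $A$ is a linear map $\Theta:\mathfrak L(A,A)\to\mathfrak L(A,A)$ such that, for all systems $E,F$, the map $\Theta_A\otimes\mathrm{id}:\mathfrak L(AE,AF)\to\mathfrak L(AE,AF)$ (here $\mathrm{id}$ is the identity on $\mathfrak L(E,F)$) sends quantum channels to quantum channels. For systems $A_0,B_0,A_1,B_1$, unitaries $U_0\in\mathfrak U(A_0B_0)$, $U_1\in\mathfrak U(A_1B_1)$ and a state $\sigma_{B_0B_1}$, the pair $(U_0,U_1)$ is called compatible up to local unitary with the delocalized catalyst $\sigma_{B_0B_1}$ if there are $V_0\in\mathfrak U(B_0)$ and $V_1\in\mathfrak U(B_1)$ such that, for all $\rho_{A_0A_1}\in\mathfrak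 S(A_0A_1)$, $$\mathrm{Tr}_{A_0A_1}\big[\mathrm{Ad}_{U_0\otimes U_1}(\rho_{A_0A_1}\otimes\sigma_{B_0B_1})\big]=\mathrm{Ad}_{V_0\otimes V_1}(\sigma_{B_0B_1}).$$ Theorem. Let $U\in\mathfrak U(AB)$ and $\sigma_{AB}\in\mathfrak S(AB)$, and let $A_1$ be any system of dimension at least $1$. The following are equivalent. (S:A) There is $\eta_B\in\mathfrak S(B)$ such that $\mathrm{Tr}_A\big[\big((\Theta_A\otimes\mathrm{id}_{\mathfrak L(B,B)})(\mathrm{Ad}_U)\big)(\sigma_{AB})\big]=\eta_B$ for every superchannel $\Theta$ on $A$. (S:B) For every system $R$ and every channel $\mathcal N\in\mathfrak C(A,RA)$ there is $V\in\mathfrak U(B)$ such that $\tau_{RAB}:=(\mathcal N\otimes\mathrm{id}_B)(\sigma_{AB})$ satisfies $$\mathrm{Tr}_A\big[(\mathrm{id}_R\otimes\mathrm{Ad}_U)(\tau_{RAB})\big]=(\mathrm{id}_R\otimes\mathrm{Ad}_V)(\mathrm{Tr}_A[\tau_{RAB}]).$$ (S:B$'$) As (S:B), with one and the same $V\in\mathfrak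 U(B)$ for all $R$ and all $\mathcal N$. (S:C) $U$ is compatible with $\sigma_{AB}$ on $B$ up to local unitary as a delocalized catalyst: regarding $U$ as a unitary on $A_0B$ with $A_0$ a copy of $A$, the pair $(U,\mathbf 1_{A_1A})$ is compatible up to local unitary with the delocalized catalyst $\sigma_{AB}$, where $B_0=B$ and $B_1=A$. (S:C$'$) As (S:C), with the local unitary acting on $B$ only, i.e. with $V_1=\mathbf 1_A$. -/

import Mathlib

open scoped Kronecker Matrix ComplexOrder

noncomputable section

namespace QInfo

/-!
Finite-dimensional quantum systems. A system is a finite type `X` that labels an orthonormal basis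
of its Hilbert space, `Matrix X X ℂ` is the algebra of operators on it, and `X × Y` labels the
product basis of the tensor product of the systems `X` and `Y`.
-/

/-- Operators on the system `X`. -/
abbrev Op (X : Type*) := Matrix X X ℂ

/-- Linear maps from operators on `X` to operators on `Y`. -/
abbrev LMap (X Y : Type*) := Op X →ₗ[ℂ] Op Y

/-- Supermaps from `X` to `Y`: linear maps from `LMap X X` to `LMap Y Y`. -/
abbrev SMap (X Y : Type*) := LMap X X →ₗ[ℂ] LMap Y Y

section Basic

variable {X Y E F : Type*}

/-- Density matrices. -/
def IsState [Fintype X] (ρ : Op X) : Prop := ρ.PosSemidef ∧ ρ.trace = 1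

/-- `Ad_M (K) = M K M†`. -/
def Ad [Fintype X] (M : Op X) : LMap X X where
  toFun K := M * K * Mᴴ
  map_add' K L := by rw [Matrix.mul_add, Matrix.add_mul]
  map_smul' c K := by rw [Matrix.mul_smul, Matrix.smul_mul, RingHom.id_apply]

/-- Relabelling of the basis along a bijection: `relabel f K` has the entry `K x x'` at the place
`(f x, f x')`. It is used to reorder and regroup tensor factors. -/
def relabel (f : X ≃ Y) : LMap X Y where
  toFun K := Matrix.reindex f f K
  map_add' _ _ := rfl
  map_smul' _ _ := rfl

/-- The block `⟨e| Z |e'⟩` of an operator `Z` on `X ⊗ E`. -/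
def block (e e' : E) : LMap (X × E) X where
  toFun Z := Matrix.of fun x x' => Z (x, e) (x', e')
  map_add' _ _ := rfl
  map_smul' _ _ := rfl

/-- `K ↦ K ⊗ |e⟩⟨e'|`. -/
def embed [DecidableEq E] (e e' : E) : LMap X (X × E) where
  toFun K := K ⊗ₖ Matrix.single e e' (1 : ℂ)
  map_add' K L := Matrix.add_kronecker K L _
  map_smul' c K := Matrix.smul_kronecker c K _

/-- The partial trace `Tr_X` over the first factor of `X ⊗ Y`. -/
def trFst (X Y : Type*) [Fintype X] : LMap (X × Y) Y where
  toFun Z := Matrix.of fun y y' => ∑ x, Z (x, y) (x, y')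
  map_add' Z W := by ext y y'; simp [Finset.sum_add_distrib]
  map_smul' c Z := by ext y y'; simp [Finset.mul_sum]

/-- `N ⊗ id_E`, acting on the first factor. -/
def tensorId (E : Type*) [Fintype E] [DecidableEq E] (N : LMap X Y) : LMap (X × E) (Y × E) :=
  ∑ e : E, ∑ e' : E, embed e e' ∘ₗ N ∘ₗ block e e'

/-- `id_E ⊗ N`, acting on the second factor. -/
def idTensor (E : Type*) [Fintype E] [DecidableEq E] (N : LMap X Y) : LMap (E × X) (E × Y) :=
  relabel (Equiv.prodComm Y E) ∘ₗ tensorId E N ∘ₗ relabel (Equiv.prodComm E X)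

/-- Complete positivity: `N ⊗ id_k` preserves positive semidefiniteness for every `k`. -/
def IsCP [Fintype X] [Fintype Y] (N : LMap X Y) : Prop :=
  ∀ (k : ℕ) (Z : Op (X × Fin k)), Z.PosSemidef → (tensorId (Fin k) N Z).PosSemidef

/-- Quantum channels: completely positive trace-preserving linear maps. -/
def IsChannel [Fintype X] [Fintype Y] (N : LMap X Y) : Prop :=
  IsCP N ∧ ∀ K : Op X, (N K).trace = K.trace

/-- `Θ ⊗ id`, the supermap `Θ` applied to the `X`-part of a map from `X ⊗ E` to `X ⊗ F`: if
`L = ∑ L_{e e' f f'} ⊗ (|f⟩⟨f'| ⟨e| · |e'⟩)` then the result is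
`∑ Θ(L_{e e' f f'}) ⊗ (|f⟩⟨f'| ⟨e| · |e'⟩)`. -/
def superTensorId [Fintype E] [DecidableEq E] [Fintype F] [DecidableEq F]
    (Θ : SMap X Y) (L : LMap (X × E) (X × F)) : LMap (Y × E) (Y × F) :=
  ∑ e : E, ∑ e' : E, ∑ f : F, ∑ f' : F,
    embed f f' ∘ₗ Θ (block f f' ∘ₗ L ∘ₗ embed e e') ∘ₗ block e e'

/-- Superchannels: supermaps that take quantum channels to quantum channels, even when they act on
a part of a multipartite channel. -/
def IsSuperchannel [Fintype X] [Fintype Y] (Θ : SMap X Y) : Prop :=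
  ∀ (E F : Type) [Fintype E] [DecidableEq E] [Fintype F] [DecidableEq F]
    (L : LMap (X × E) (X × F)), IsChannel L → IsChannel (superTensorId Θ L)

end Basic

section Delocalized

variable {A₀ A₁ B₀ B₁ : Type*} [Fintype A₀] [DecidableEq A₀] [Fintype A₁] [DecidableEq A₁]
  [Fintype B₀] [DecidableEq B₀] [Fintype B₁] [DecidableEq B₁]

/-- The marginal on `B₀ B₁` of `Ad_{U₀ ⊗ U₁} (ρ_{A₀A₁} ⊗ σ_{B₀B₁})`, where `U₀` acts on `A₀ B₀` and
`U₁` acts on `A₁ B₁`. -/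
def catalystOutput (U₀ : Op (A₀ × B₀)) (U₁ : Op (A₁ × B₁)) (ρ : Op (A₀ × A₁)) (σ : Op (B₀ × B₁)) :
    Op (B₀ × B₁) :=
  trFst (A₀ × A₁) (B₀ × B₁)
    (Ad (relabel (Equiv.prodProdProdComm A₀ B₀ A₁ B₁) (U₀ ⊗ₖ U₁)) (ρ ⊗ₖ σ))

/-- The pair `(U₀, U₁)` takes the delocalized catalyst `σ_{B₀B₁}` to `Ad_{V₀ ⊗ V₁} (σ_{B₀B₁})`,
whatever the state of `A₀ A₁` is. -/
def CompatibleVia (U₀ : Op (A₀ × B₀)) (U₁ : Op (A₁ × B₁)) (σ : Op (B₀ × B₁))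
    (V₀ : Op B₀) (V₁ : Op B₁) : Prop :=
  ∀ ρ : Op (A₀ × A₁), IsState ρ → catalystOutput U₀ U₁ ρ σ = Ad (V₀ ⊗ₖ V₁) σ

/-- The pair `(U₀, U₁)` is compatible up to local unitary with the delocalized catalyst
`σ_{B₀B₁}`. -/
def CompatibleUpToLocalUnitary (U₀ : Op (A₀ × B₀)) (U₁ : Op (A₁ × B₁)) (σ : Op (B₀ × B₁)) : Prop :=
  ∃ V₀ ∈ Matrix.unitaryGroup B₀ ℂ, ∃ V₁ ∈ Matrix.unitaryGroup B₁ ℂ, CompatibleVia U₀ U₁ σ V₀ V₁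

end Delocalized

section Semantic

variable {A B : Type*} [Fintype A] [DecidableEq A] [Fintype B] [DecidableEq B]

/-- (S:A) One state `η` is the `B`-marginal of the output of `(Θ_A ⊗ id_B)(Ad_U)` on `σ_{AB}` for
every superchannel `Θ` on `A`. -/
def SemA (U σ : Op (A × B)) : Prop :=
  ∃ η : Op B, IsState η ∧ ∀ Θ : SMap A A, IsSuperchannel Θ →
    trFst A B (superTensorId Θ (Ad U) σ) = η

/-- For the state `τ_{RAB} = (N_{A → RA} ⊗ id_B)(σ_{AB})`:
`Tr_A [(id_R ⊗ Ad_U)(τ_{RAB})] = (id_R ⊗ Ad_V)(τ_{RB})`. -/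
def LocalChange (U σ : Op (A × B)) {R : Type*} [Fintype R] [DecidableEq R]
    (N : LMap A (R × A)) (V : Op B) : Prop :=
  let τ : Op (R × (A × B)) := relabel (Equiv.prodAssoc R A B) (tensorId B N σ)
  idTensor R (trFst A B) (idTensor R (Ad U) τ) = idTensor R (Ad V) (idTensor R (trFst A B) τ)

/-- (S:B) For every channel `N_{A → RA}`, the `RB` marginal changes by a unitary on `B` only. -/
def SemB (U σ : Op (A × B)) : Prop :=
  ∀ (R : Type) [Fintype R] [DecidableEq R] (N : LMap A (R × A)), IsChannel N →
    ∃ V ∈ Matrix.unitaryGroup B ℂ, LocalChange U σ N V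

/-- (S:B) with one unitary on `B` for all `R` and all channels. -/
def SemBUniform (U σ : Op (A × B)) : Prop :=
  ∃ V ∈ Matrix.unitaryGroup B ℂ,
    ∀ (R : Type) [Fintype R] [DecidableEq R] (N : LMap A (R × A)), IsChannel N →
      LocalChange U σ N V

/-- (S:C) `U` is compatible with `σ_{AB}` on `B` up to local unitary as a delocalized catalyst.
The catalyst `σ_{B₀B₁}` is `σ_{AB}` with `B₀ = B`, `B₁ = A`; `U` acts on `A₀ B₀` where `A₀` is
another copy of `A`, and nothing is done on `A₁ B₁`. -/
def SemC (A₁ : Type*) [Fintype A₁] [DecidableEq A₁] (U σ : Op (A × B)) : Prop :=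
  CompatibleUpToLocalUnitary U (1 : Op (A₁ × A)) (relabel (Equiv.prodComm A B) σ)

/-- (S:C) with a local unitary on `B` only. -/
def SemCOnB (A₁ : Type*) [Fintype A₁] [DecidableEq A₁] (U σ : Op (A × B)) : Prop :=
  ∃ V ∈ Matrix.unitaryGroup B ℂ,
    CompatibleVia U (1 : Op (A₁ × A)) (relabel (Equiv.prodComm A B) σ) V 1

end Semantic

end QInfo

end

/-! Write d = dim A, U_{ki} for the blocks ⟨k|U|i⟩ on B, and σ_{cc'} for the blocks ⟨c|σ|c'⟩ on B.
All five conditions amount to `MarginalFree`: for some operators η_{cc'}, Tr_A[U (K ⊗ σ_{cc'}) U†] =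
Tr(K) η_{cc'} for every K. A fresh input on A, with the original A kept as a spectator, then leaves
no imprint on the rest.

The crux is that the family η is then σ rotated by a unitary on B. First, rigidity
(`intertwines_of_marginal`): comparing complementary marginals of a pure state shows that the purity
of η is at least that of σ, while ∑ ‖(1 ⊗ U_{ki}) σ - η (1 ⊗ U_{ki})‖² = d (Tr σ² - Tr η²). Hence
U_{ki} σ_{cc'} = η_{cc'} U_{ki}. Second, cancellation (`exists_unitary_intertwiner`): U is an
equivalence between d copies of the family σ_{cc'} and d copies of η_{cc'}; both are closed under
adjoints, so finite multiplicities cancel and one V on B intertwines them. In place of a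
decomposition into irreducibles, an intertwiner of minimal kernel is shown injective by a dimension
count, and polar decomposition makes it unitary.

`MarginalFree` is extracted by testing: (S:A) with preprocessing channels, (S:B) with half of a
maximally entangled state, (S:C) with product inputs. Conversely it yields (S:A) because a
superchannel preserves the factor by which a map scales the trace (`IsSuperchannel.trace_apply`). -/

noncomputable section

namespace QInfo

/-! ### Rigidity of unitaries with an input-independent marginal -/

section MarginalRigidity

variable {ι Y Z : Type*} [Fintype ι] [Fintype Y] [Fintype Z]

theorem re_trace_mul_conjTranspose_nonneg (M : Matrix Y Z ℂ) : 0 ≤ (M * Mᴴ).trace.re :=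
  (Complex.le_def.1 (Matrix.posSemidef_self_mul_conjTranspose M).trace_nonneg).1

/-- A pure state has the same purity on two complementary subsystems. -/
theorem sum_trace_gram_eq (Q : ι → ι → Matrix Y Z ℂ) :
    ∑ i, ∑ j, ((∑ a, Q a i * (Q a j)ᴴ) * (∑ a, Q a i * (Q a j)ᴴ)ᴴ).trace =
      ∑ a, ∑ b, ((∑ i, (Q a i)ᴴ * Q b i) * (∑ i, (Q a i)ᴴ * Q b i)ᴴ).trace := by
  have h₁ : ∀ i j, ((∑ a, Q a i * (Q a j)ᴴ) * (∑ a, Q a i * (Q a j)ᴴ)ᴴ).trace =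
      ∑ a, ∑ b, (Q a i * (Q a j)ᴴ * (Q b j * (Q b i)ᴴ)).trace := by
    intro i j
    rw [Finset.sum_comm]
    simp [Matrix.conjTranspose_sum, Finset.sum_mul, Finset.mul_sum, Matrix.trace_sum]
  have h₂ : ∀ a b, ((∑ i, (Q a i)ᴴ * Q b i) * (∑ i, (Q a i)ᴴ * Q b i)ᴴ).trace =
      ∑ j, ∑ i, (Q a i * (Q a j)ᴴ * (Q b j * (Q b i)ᴴ)).trace := by
    intro a b
    simp only [Matrix.conjTranspose_sum, Finset.sum_mul, Finset.mul_sum, Matrix.trace_sum,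
      Matrix.conjTranspose_mul, Matrix.conjTranspose_conjTranspose]
    rw [Finset.sum_comm]
    refine Finset.sum_congr rfl fun j _ => Finset.sum_congr rfl fun i _ => ?_
    rw [← Matrix.mul_assoc, Matrix.trace_mul_comm]
    simp only [Matrix.mul_assoc]
  simp_rw [h₁, h₂]
  calc _ = ∑ i, ∑ a, ∑ j, ∑ b, (Q a i * (Q a j)ᴴ * (Q b j * (Q b i)ᴴ)).trace :=
        Finset.sum_congr rfl fun i _ => Finset.sum_comm
    _ = ∑ a, ∑ i, ∑ j, ∑ b, (Q a i * (Q a j)ᴴ * (Q b j * (Q b i)ᴴ)).trace := Finset.sum_comm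
    _ = ∑ a, ∑ i, ∑ b, ∑ j, (Q a i * (Q a j)ᴴ * (Q b j * (Q b i)ᴴ)).trace :=
        Finset.sum_congr rfl fun a _ => Finset.sum_congr rfl fun i _ => Finset.sum_comm
    _ = ∑ a, ∑ b, ∑ i, ∑ j, (Q a i * (Q a j)ᴴ * (Q b j * (Q b i)ᴴ)).trace :=
        Finset.sum_congr rfl fun a _ => Finset.sum_comm
    _ = _ := Finset.sum_congr rfl fun a _ => Finset.sum_congr rfl fun b _ => Finset.sum_comm

open scoped MatrixOrder Matrix.Norms.L2Operator in
/-- If the marginal `∑ₖ P k i X (P k j)ᴴ` of a unitary with blocks `P k i` does not depend on the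
input on the first factor, then its purity is at least that of `X`. -/
theorem purity_le_of_marginal [DecidableEq ι] [DecidableEq Y] [Nonempty ι] {P : ι → ι → Matrix Y Y ℂ}
    (h₁ : ∀ i j, ∑ k, (P k i)ᴴ * P k j = if i = j then 1 else 0) {X η : Matrix Y Y ℂ}
    (hX : X.PosSemidef) (hη : ∀ i j, ∑ k, P k i * X * (P k j)ᴴ = if i = j then η else 0) :
    (X * Xᴴ).trace.re ≤ (η * ηᴴ).trace.re := by
  obtain ⟨L, hL⟩ : ∃ L : Matrix Y Y ℂ, X = L * Lᴴ := by
    obtain ⟨B, hB⟩ := CStarAlgebra.nonneg_iff_eq_star_mul_self.1 hX.nonneg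
    exact ⟨Bᴴ, by simpa [Matrix.star_eq_conjTranspose] using hB⟩
  -- One marginal of the vector with blocks `P a i * L` has blocks δ_ij η. The complementary one has
  -- blocks `H a b`; the mean of its diagonal blocks is `S = Lᴴ * L`, which has the purity of `X`.
  have key := congrArg Complex.re (sum_trace_gram_eq fun a i => P a i * L)
  set S : Matrix Y Y ℂ := Lᴴ * L with hS
  have hSS : (S * Sᴴ).trace = (X * Xᴴ).trace := by
    simp only [hS, hL, Matrix.conjTranspose_mul, Matrix.conjTranspose_conjTranspose]
    rw [Matrix.mul_assoc, Matrix.trace_mul_comm]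
    simp only [Matrix.mul_assoc]
  set H : ι → ι → Matrix Y Y ℂ := fun a b => ∑ i, (P a i * L)ᴴ * (P b i * L) with hH
  have hG : ∀ i j, ∑ a, P a i * L * (P a j * L)ᴴ = if i = j then η else 0 := by
    intro i j
    rw [← hη, hL]
    simp only [Matrix.conjTranspose_mul, Matrix.mul_assoc]
  have hHsum : ∑ a, H a a = (Fintype.card ι : ℂ) • S := by
    have : ∀ i, ∑ a, (P a i * L)ᴴ * (P a i * L) = S := by
      intro i
      calc _ = Lᴴ * (∑ a, (P a i)ᴴ * P a i) * L := by
            simp only [Finset.mul_sum, Finset.sum_mul, Matrix.conjTranspose_mul, Matrix.mul_assoc]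
        _ = S := by rw [h₁]; simp [hS]
    simp only [hH]
    rw [Finset.sum_comm]
    rw [Finset.sum_congr rfl fun i _ => this i, Finset.sum_const, Finset.card_univ,
      ← Nat.cast_smul_eq_nsmul ℂ]
  have hd : (0 : ℝ) < Fintype.card ι := by exact_mod_cast Fintype.card_pos
  have hl : (∑ i, ∑ j, ((∑ a, P a i * L * (P a j * L)ᴴ) *
      (∑ a, P a i * L * (P a j * L)ᴴ)ᴴ).trace).re = Fintype.card ι * (η * ηᴴ).trace.re := by
    simp_rw [hG]
    have : ∀ i j : ι, (((if i = j then η else 0) * (if i = j then η else 0)ᴴ).trace) =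
        if i = j then (η * ηᴴ).trace else 0 := by
      intro i j; split_ifs <;> simp
    simp_rw [this]
    simp
  have hdiag : ∑ a, (H a a * (H a a)ᴴ).trace.re ≤ (∑ a, ∑ b, (H a b * (H a b)ᴴ).trace).re := by
    simp only [Complex.re_sum]
    refine Finset.sum_le_sum fun a _ => ?_
    exact Finset.single_le_sum (f := fun b => (H a b * (H a b)ᴴ).trace.re)
      (fun b _ => re_trace_mul_conjTranspose_nonneg (H a b)) (Finset.mem_univ a)
  -- The variance of the `H a a` about their mean `S` is nonnegative, so ∑ ‖H a a‖² ≥ d ‖S‖².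
  have hcs : (0 : ℝ) ≤ ∑ a, ((H a a - S) * (H a a - S)ᴴ).trace.re :=
    Finset.sum_nonneg fun a _ => re_trace_mul_conjTranspose_nonneg _
  have hexp : ∑ a, ((H a a - S) * (H a a - S)ᴴ).trace.re =
      ∑ a, (H a a * (H a a)ᴴ).trace.re - Fintype.card ι * (S * Sᴴ).trace.re := by
    have e : ∑ a, ((H a a - S) * (H a a - S)ᴴ).trace =
        ∑ a, (H a a * (H a a)ᴴ).trace - ((∑ a, H a a) * Sᴴ).trace -
          (S * (∑ a, H a a)ᴴ).trace + Fintype.card ι * (S * Sᴴ).trace := by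
      simp only [Matrix.conjTranspose_sub, Matrix.sub_mul, Matrix.mul_sub, Matrix.trace_sub,
        Finset.sum_sub_distrib, Finset.sum_mul, Finset.mul_sum, Matrix.conjTranspose_sum,
        Matrix.trace_sum, Finset.sum_const, Finset.card_univ, nsmul_eq_mul]
      ring
    rw [hHsum, Matrix.conjTranspose_smul, star_natCast] at e
    have e' := congrArg Complex.re e
    simp only [Matrix.smul_mul, Matrix.mul_smul, Matrix.trace_smul,
      Complex.re_sum, Complex.add_re, Complex.sub_re, smul_eq_mul,
      ← Complex.ofReal_natCast, Complex.re_ofReal_mul] at e'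
    linarith
  rw [hl] at key
  rw [← hSS]
  have : Fintype.card ι * (S * Sᴴ).trace.re ≤ Fintype.card ι * (η * ηᴴ).trace.re := by
    rw [key]; linarith
  exact le_of_mul_le_mul_left this hd

/-- If the marginal on the second factor of a unitary with blocks `P k i`, applied to `K ⊗ X` with
`X` positive semidefinite, is `Tr(K) η`, then the unitary takes `1 ⊗ X` to `1 ⊗ η`. -/
theorem intertwines_of_marginal [DecidableEq ι] [DecidableEq Y] {P : ι → ι → Matrix Y Y ℂ}
    (h₁ : ∀ i j, ∑ k, (P k i)ᴴ * P k j = if i = j then 1 else 0)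
    (h₂ : ∀ i j, ∑ k, P i k * (P j k)ᴴ = if i = j then 1 else 0) {X η : Matrix Y Y ℂ}
    (hX : X.PosSemidef) (hη : ∀ i j, ∑ k, P k i * X * (P k j)ᴴ = if i = j then η else 0)
    (k i : ι) : P k i * X = η * P k i := by
  have : Nonempty ι := ⟨k⟩
  have hXH : Xᴴ = X := hX.isHermitian
  have hηH : ηᴴ = η := by
    have := hη k k
    rw [if_pos rfl] at this
    rw [← this]
    simp [Matrix.conjTranspose_sum, hXH, Matrix.mul_assoc]
  have hp := purity_le_of_marginal h₁ hX hη
  -- Expanding the square, `e₁` gives d Tr X², the cross terms `e₂` and `e₃` give -d Tr η² each, and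
  -- `e₄` gives d Tr η². With the purity bound the total is at most zero.
  have e : ∑ k, ∑ i, ((P k i * X - η * P k i) * (P k i * X - η * P k i)ᴴ).trace =
      Fintype.card ι * ((X * Xᴴ).trace - (η * ηᴴ).trace) := by
    have e₁ : ∀ i, ∑ k, (P k i * X * (X * (P k i)ᴴ)).trace = (X * X).trace := by
      intro i
      have := congrArg (fun M => (M * (X * X)).trace) (h₁ i i)
      simp only [if_true, one_mul, Finset.sum_mul, Matrix.trace_sum] at this
      rw [← this]
      refine Finset.sum_congr rfl fun k _ => ?_
      rw [Matrix.mul_assoc (P k i)ᴴ, Matrix.trace_mul_comm (P k i)ᴴ]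
      simp only [Matrix.mul_assoc]
    have e₂ : ∀ i, ∑ k, (P k i * X * ((P k i)ᴴ * η)).trace = (η * η).trace := by
      intro i
      have := congrArg (fun M => (M * η).trace) (hη i i)
      simpa only [if_true, Finset.sum_mul, Matrix.trace_sum, Matrix.mul_assoc] using this
    have e₃ : ∀ i, ∑ k, (η * P k i * (X * (P k i)ᴴ)).trace = (η * η).trace := by
      intro i
      have := congrArg (fun M => (η * M).trace) (hη i i)
      simpa only [if_true, Finset.mul_sum, Matrix.trace_sum, Matrix.mul_assoc] using this
    have e₄ : ∀ k, ∑ i, (η * P k i * ((P k i)ᴴ * η)).trace = (η * η).trace := by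
      intro k
      have := congrArg (fun M => (η * M * η).trace) (h₂ k k)
      simpa only [if_true, Finset.mul_sum, Finset.sum_mul, Matrix.trace_sum, Matrix.mul_assoc,
        Matrix.mul_one, Matrix.one_mul] using this
    simp only [Matrix.conjTranspose_sub, Matrix.conjTranspose_mul, hXH, hηH, Matrix.sub_mul,
      Matrix.mul_sub, Matrix.trace_sub, Finset.sum_sub_distrib, e₄]
    rw [Finset.sum_comm, Finset.sum_comm (f := fun k i => (η * P k i * (X * (P k i)ᴴ)).trace),
      Finset.sum_comm (f := fun k i => (P k i * X * ((P k i)ᴴ * η)).trace)]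
    simp only [e₁, e₂, e₃, Finset.sum_const, Finset.card_univ, nsmul_eq_mul]
    ring
  have hz : ∑ k, ∑ i, ((P k i * X - η * P k i) * (P k i * X - η * P k i)ᴴ).trace.re ≤ 0 := by
    have e' := congrArg Complex.re e
    simp only [Complex.re_sum] at e'
    rw [e', ← Complex.ofReal_natCast, Complex.re_ofReal_mul, Complex.sub_re]
    exact mul_nonpos_of_nonneg_of_nonpos (Nat.cast_nonneg _) (by linarith)
  have hnn : ∀ k i, 0 ≤ ((P k i * X - η * P k i) * (P k i * X - η * P k i)ᴴ).trace.re :=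
    fun k i => re_trace_mul_conjTranspose_nonneg _
  have h0 : ((P k i * X - η * P k i) * (P k i * X - η * P k i)ᴴ).trace.re = 0 := by
    refine le_antisymm (le_trans ?_ hz) (hnn k i)
    exact (Finset.single_le_sum (f := fun i => _) (fun i _ => hnn k i) (Finset.mem_univ i)).trans
      (Finset.single_le_sum (f := fun k => _) (fun k _ => Finset.sum_nonneg fun i _ => hnn k i)
        (Finset.mem_univ k))
  have h0' : ((P k i * X - η * P k i) * (P k i * X - η * P k i)ᴴ).trace = 0 := by
    have := (Complex.le_def.1 (Matrix.posSemidef_self_mul_conjTranspose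
      (P k i * X - η * P k i)).trace_nonneg).2
    exact Complex.ext h0 this.symm
  exact sub_eq_zero.1 (Matrix.trace_mul_conjTranspose_self_eq_zero_iff.1 h0')

end MarginalRigidity

/-! ### Cancellation of multiplicities for self-adjoint families -/

section Cancellation

variable {ι Y J : Type*} [Fintype ι] [DecidableEq ι] [Fintype Y]

/-- An operator `Q` that commutes with everything that commutes with the Hermitian operator `T`
and acts as the projection onto the kernel of `T`. -/
theorem exists_kernel_projection [DecidableEq Y] {T : Matrix Y Y ℂ} (hT : T.IsHermitian) :
    ∃ Q R : Matrix Y Y ℂ, T * Q = 0 ∧ Qᴴ = Q ∧ 1 - Q = R * T ∧ ∀ b, Commute T b → Commute Q b := by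
  -- Since 0⁻¹ = 0, the function x⁻¹ x is the indicator of x ≠ 0, which gives `1 - Q = R * T`.
  refine ⟨cfc (fun x : ℝ => if x = 0 then 1 else 0) T, cfc (fun x : ℝ => x⁻¹) T, ?_, ?_, ?_, ?_⟩
  all_goals
    have hc : ∀ f : ℝ → ℝ, ContinuousOn f (spectrum ℝ T) := fun f =>
      (Matrix.finite_real_spectrum (A := T)).continuousOn f
    have hT' : IsSelfAdjoint T := hT
  · conv_lhs => enter [1]; rw [← cfc_id ℝ T]
    rw [← cfc_mul _ _ T (hc _) (hc _)]
    convert cfc_const_zero ℝ T using 2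
    ext x; by_cases hx : x = 0 <;> simp [hx]
  · exact (cfc_predicate (R := ℝ) (fun x : ℝ => if x = 0 then 1 else 0) T : IsSelfAdjoint _)
  · conv_rhs => enter [2]; rw [← cfc_id ℝ T]
    rw [← cfc_mul _ _ T (hc _) (hc _), ← cfc_const_one ℝ T, ← cfc_sub _ _ T (hc _) (hc _)]
    congr 1
    ext x; by_cases hx : x = 0 <;> simp [hx]
  · intro b hb
    exact hb.cfc_real _

/-- `F` intertwines the families `x` and `y`. -/
def Intertwines (x y : J → Matrix Y Y ℂ) (F : Matrix Y Y ℂ) : Prop := ∀ j, F * x j = y j * F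

theorem Intertwines.conjTranspose {x y : J → Matrix Y Y ℂ} {s : J → J}
    (hx : ∀ j, (x j)ᴴ = x (s j)) (hy : ∀ j, (y j)ᴴ = y (s j)) (hs : ∀ j, s (s j) = j)
    {F : Matrix Y Y ℂ} (hF : Intertwines x y F) : Intertwines y x Fᴴ := by
  intro j
  have := congrArg Matrix.conjTranspose (hF (s j))
  simpa [hx, hy, hs] using this.symm

theorem Intertwines.mul {x y z : J → Matrix Y Y ℂ} {F G : Matrix Y Y ℂ}
    (hG : Intertwines y z G) (hF : Intertwines x y F) : Intertwines x z (G * F) := by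
  intro j
  rw [Matrix.mul_assoc, hF j, ← Matrix.mul_assoc, hG j, Matrix.mul_assoc]

/-- Among the intertwiners there is one whose kernel lies in the kernel of every intertwiner with
orthogonal range. -/
theorem exists_minimal_intertwiner (x y : J → Matrix Y Y ℂ) :
    ∃ F, Intertwines x y F ∧ ∀ G, Intertwines x y G → Fᴴ * G = 0 →
      ∀ v, F *ᵥ v = 0 → G *ᵥ v = 0 := by
  classical
  let k : Matrix Y Y ℂ → ℕ := fun F => Module.finrank ℂ (LinearMap.ker (Matrix.mulVecLin F))
  let S : Set (Matrix Y Y ℂ) := {F | Intertwines x y F}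
  have hS : S.Nonempty := ⟨0, fun j => by simp⟩
  obtain ⟨F, hF, hmin⟩ : ∃ F ∈ S, ∀ G ∈ S, k F ≤ k G :=
    ⟨Function.argminOn k S hS, Function.argminOn_mem k S hS,
      fun G hG => Function.argminOn_le k S hG⟩
  refine ⟨F, hF, fun G hG hFG v hv => ?_⟩
  -- The ranges of `F` and `G` are orthogonal, so `F + G` kills only what both kill. Minimality of
  -- the kernel of `F` then forces equality of the kernels.
  have hle : LinearMap.ker (Matrix.mulVecLin (F + G)) ≤ LinearMap.ker (Matrix.mulVecLin F) := by
    intro w hw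
    simp only [LinearMap.mem_ker, Matrix.mulVecLin_apply] at hw ⊢
    have : (Fᴴ * F) *ᵥ w = 0 := by
      have h := congrArg (Fᴴ *ᵥ ·) hw
      simpa [Matrix.mul_add, hFG] using h
    exact (Matrix.conjTranspose_mul_self_mulVec_eq_zero F w).1 this
  have hmem : F + G ∈ S := fun j => by rw [Matrix.add_mul, Matrix.mul_add, hF j, hG j]
  have heq := Submodule.eq_of_le_of_finrank_le hle (hmin _ hmem)
  have hv' : v ∈ LinearMap.ker (Matrix.mulVecLin (F + G)) := by
    rw [heq]; simpa using hv
  simpa [Matrix.add_mulVec, hv] using hv'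

/-- If the blocks of an operator with a left inverse intertwine two self-adjoint families, then some
invertible operator on one copy of the space does. -/
theorem exists_injective_intertwiner [DecidableEq Y] [Nonempty ι] {u : ι → ι → Matrix Y Y ℂ}
    (h₁ : ∀ i j, ∑ k, (u k i)ᴴ * u k j = if i = j then 1 else 0) {x y : J → Matrix Y Y ℂ}
    {s : J → J} (hx : ∀ j, (x j)ᴴ = x (s j)) (hy : ∀ j, (y j)ᴴ = y (s j)) (hs : ∀ j, s (s j) = j)
    (hu : ∀ k i, Intertwines x y (u k i)) :
    ∃ F, Intertwines x y F ∧ ∀ v, F *ᵥ v = 0 → v = 0 := by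
  obtain ⟨F, hF, hmin⟩ := exists_minimal_intertwiner x y
  refine ⟨F, hF, ?_⟩
  have hF' : Intertwines y x Fᴴ := hF.conjTranspose hx hy hs
  let H : Submodule ℂ (Y → ℂ) :=
    ⨅ G : {G : Matrix Y Y ℂ // Intertwines x y G ∧ Fᴴ * G = 0}, LinearMap.ker (Matrix.mulVecLin G.1)
  have hH : ∀ v, v ∈ H ↔ ∀ G, Intertwines x y G → Fᴴ * G = 0 → G *ᵥ v = 0 := by
    intro v; simp [H, Submodule.mem_iInf]
  have hker : ∀ v, F *ᵥ v = 0 → v ∈ H := fun v hv => (hH v).2 fun G hG hFG => hmin G hG hFG v hv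
  -- `H` contains the kernel of `F` by minimality. The operator Fᴴ u_{ai} preserves `H`: if `G` is
  -- an intertwiner with FᴴG = 0, so is G Fᴴ u_{ai}.
  let W : (ι → H) →ₗ[ℂ] (ι → H) := LinearMap.pi fun a => ∑ i,
    ((Matrix.mulVecLin (Fᴴ * u a i)).restrict (p := H) (q := H) (fun v hv => by
      rw [hH] at hv ⊢
      intro G hG hFG
      have := hv (G * (Fᴴ * u a i)) (hG.mul (hF'.mul (hu a i)))
        (by rw [← Matrix.mul_assoc, hFG, Matrix.zero_mul])
      simpa using this)) ∘ₗ LinearMap.proj i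
  have hW : ∀ h a, ((W h a : H) : Y → ℂ) = Fᴴ *ᵥ ∑ i, u a i *ᵥ (h i : Y → ℂ) := by
    intro h a
    simp [W, Matrix.mulVec_sum, LinearMap.restrict_apply]
  -- Let g_a = ∑ u_{ai} h_i and suppose Fᴴ g_a = 0. The part Q g_a vanishes because Q u_{ai} is an
  -- intertwiner annihilated by Fᴴ and h_i lies in `H`; the part (1 - Q) g_a = R F Fᴴ g_a vanishes
  -- too. So g = 0, and the left inverse of `u` gives h = 0.
  have hinj : Function.Injective W := by
    rw [← LinearMap.ker_eq_bot, LinearMap.ker_eq_bot']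
    intro h hh
    obtain ⟨Q, R, hTQ, hQ, hQR, hcomm⟩ :=
      exists_kernel_projection (Matrix.isHermitian_mul_conjTranspose_self F)
    have hFQ : Fᴴ * Q = 0 := by
      have : (Fᴴ * Q)ᴴ * (Fᴴ * Q) = 0 := by
        simp only [Matrix.conjTranspose_mul, Matrix.conjTranspose_conjTranspose, hQ]
        rw [Matrix.mul_assoc, ← Matrix.mul_assoc F, hTQ, Matrix.mul_zero]
      exact Matrix.conjTranspose_mul_self_eq_zero.1 this
    have hQy : Intertwines y y Q := fun j => hcomm (y j) (hF.mul hF' j)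
    have hg : ∀ a, ∑ i, u a i *ᵥ (h i : Y → ℂ) = 0 := by
      intro a
      set g := ∑ i, u a i *ᵥ (h i : Y → ℂ) with hgdef
      have hFg : Fᴴ *ᵥ g = 0 := by rw [← hW, hh]; simp
      have hQg : Q *ᵥ g = 0 := by
        rw [hgdef, Matrix.mulVec_sum]
        refine Finset.sum_eq_zero fun i _ => ?_
        have := (hH _).1 (h i).2 (Q * u a i) (hQy.mul (hu a i))
          (by rw [← Matrix.mul_assoc, hFQ, Matrix.zero_mul])
        simpa using this
      have : (1 - Q) *ᵥ g = 0 := by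
        rw [hQR, ← Matrix.mulVec_mulVec, ← Matrix.mulVec_mulVec, hFg]; simp
      simpa [Matrix.sub_mulVec, hQg] using this
    ext i : 2
    have : ∑ a, (u a i)ᴴ *ᵥ ∑ j, u a j *ᵥ (h j : Y → ℂ) = h i := by
      simp only [Matrix.mulVec_sum, Matrix.mulVec_mulVec]
      rw [Finset.sum_comm]
      simp only [← Matrix.sum_mulVec, h₁]
      rw [Finset.sum_eq_single i] <;> simp +contextual [eq_comm]
    rw [← this]
    simp [hg]
  -- By finite dimension `W` is onto, so a vector of `ker F ≤ H` has the form Fᴴ w. Then F Fᴴ w = 0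
  -- forces Fᴴ w = 0.
  have hsurj : Function.Surjective W := LinearMap.injective_iff_surjective.1 hinj
  intro v hv
  obtain ⟨h, hh⟩ := hsurj fun _ => ⟨v, hker v hv⟩
  obtain ⟨a⟩ := ‹Nonempty ι›
  have hva : v = Fᴴ *ᵥ ∑ i, u a i *ᵥ (h i : Y → ℂ) := by rw [← hW, hh]
  rw [hva] at hv ⊢
  rw [Matrix.mulVec_mulVec] at hv
  simpa using (Matrix.self_mul_conjTranspose_mulVec_eq_zero F _).1 hv

open scoped MatrixOrder Matrix.Norms.L2Operator in
/-- Polar decomposition: an injective intertwiner yields a unitary one. -/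
theorem exists_unitary_intertwiner_of_injective [DecidableEq Y] {x y : J → Matrix Y Y ℂ} {s : J → J}
    (hx : ∀ j, (x j)ᴴ = x (s j)) (hy : ∀ j, (y j)ᴴ = y (s j)) (hs : ∀ j, s (s j) = j)
    {F : Matrix Y Y ℂ} (hF : Intertwines x y F) (hinj : ∀ v, F *ᵥ v = 0 → v = 0) :
    ∃ V ∈ Matrix.unitaryGroup Y ℂ, Intertwines x y V := by
  have hT : (Fᴴ * F).IsHermitian := Matrix.isHermitian_conjTranspose_mul_self F
  have hF' : Intertwines y x Fᴴ := hF.conjTranspose hx hy hs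
  have hc : ∀ f : ℝ → ℝ, ContinuousOn f (spectrum ℝ (Fᴴ * F)) := fun f =>
      (Matrix.finite_real_spectrum (A := Fᴴ * F)).continuousOn f
  have hT' : IsSelfAdjoint (Fᴴ * F) := hT
  have hpd : (Fᴴ * F).PosDef := by
    refine Matrix.PosDef.conjTranspose_mul_self F fun v w hvw => ?_
    exact sub_eq_zero.1 (hinj _ (by rw [Matrix.mulVec_sub]; exact sub_eq_zero.2 hvw))
  have hpos : ∀ t ∈ spectrum ℝ (Fᴴ * F), 0 < t := by
    intro t ht
    rw [hT.spectrum_real_eq_range_eigenvalues] at ht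
    obtain ⟨i, rfl⟩ := ht
    exact hpd.eigenvalues_pos i
  -- `R` is (F†F)^{-1/2}. It commutes with every `x j` because F†F does.
  set R := cfc (fun t : ℝ => (Real.sqrt t)⁻¹) (Fᴴ * F) with hR
  have hRH : Rᴴ = R := (cfc_predicate (R := ℝ) (fun t : ℝ => (Real.sqrt t)⁻¹) (Fᴴ * F) :
    IsSelfAdjoint _)
  have hRTR : R * (Fᴴ * F) * R = 1 := by
    conv_lhs => enter [1, 2]; rw [← cfc_id ℝ (Fᴴ * F)]
    rw [hR, ← cfc_mul _ _ _ (hc _) (hc _), ← cfc_mul _ _ _ (hc _) (hc _),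
      ← cfc_const_one ℝ (Fᴴ * F)]
    refine cfc_congr fun t ht => ?_
    have h0 := hpos t ht
    have := Real.sq_sqrt h0.le
    have h1 : Real.sqrt t ≠ 0 := (Real.sqrt_pos.2 h0).ne'
    simp only [id]
    field_simp
    exact this.symm
  refine ⟨F * R, ?_, ?_⟩
  · rw [Matrix.mem_unitaryGroup_iff', Matrix.star_eq_conjTranspose, Matrix.conjTranspose_mul, hRH,
      ← hRTR]
    simp only [Matrix.mul_assoc]
  · refine hF.mul fun j => ?_
    exact (show Commute (Fᴴ * F) (x j) from hF'.mul hF j).cfc_real _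

/-- Multiplicities cancel: if the blocks of a unitary on `ℂ^ι ⊗ ℂ^Y` intertwine two self-adjoint
families on `ℂ^Y`, then the families are unitarily equivalent. -/
theorem exists_unitary_intertwiner [DecidableEq Y] [Nonempty ι] {u : ι → ι → Matrix Y Y ℂ}
    (h₁ : ∀ i j, ∑ k, (u k i)ᴴ * u k j = if i = j then 1 else 0) {x y : J → Matrix Y Y ℂ}
    {s : J → J} (hx : ∀ j, (x j)ᴴ = x (s j)) (hy : ∀ j, (y j)ᴴ = y (s j)) (hs : ∀ j, s (s j) = j)
    (hu : ∀ k i, Intertwines x y (u k i)) : ∃ V ∈ Matrix.unitaryGroup Y ℂ, Intertwines x y V := by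
  obtain ⟨F, hF, hinj⟩ := exists_injective_intertwiner h₁ hx hy hs hu
  exact exists_unitary_intertwiner_of_injective hx hy hs hF hinj

end Cancellation

/-! ### Block calculus for operators, tensored maps and marginals -/

section Slices

variable {A B R X Y E F : Type*}

/-- The block `⟨e| Z |e'⟩` of an operator `Z` on `E ⊗ X`, an operator on `X`. -/
def slice (e e' : E) : LMap (E × X) X where
  toFun Z := Matrix.of fun x x' => Z (e, x) (e', x')
  map_add' _ _ := rfl
  map_smul' _ _ := rfl

@[simp] theorem slice_apply (e e' : E) (Z : Op (E × X)) (x x' : X) :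
    slice e e' Z x x' = Z (e, x) (e', x') := rfl

@[simp] theorem block_apply (e e' : E) (Z : Op (X × E)) (x x' : X) :
    block e e' Z x x' = Z (x, e) (x', e') := rfl

@[simp] theorem embed_apply [DecidableEq E] (e e' : E) (K : Op X) :
    embed e e' K = K ⊗ₖ Matrix.single e e' (1 : ℂ) := rfl

@[simp] theorem trFst_apply [Fintype X] (Z : Op (X × Y)) (y y' : Y) :
    trFst X Y Z y y' = ∑ x, Z (x, y) (x, y') := rfl

@[simp] theorem relabel_apply (f : X ≃ Y) (K : Op X) (y y' : Y) :
    relabel f K y y' = K (f.symm y) (f.symm y') := rfl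

theorem Ad_apply [Fintype X] (M K : Op X) : Ad M K = M * K * Mᴴ := rfl

theorem ext_slice {Z W : Op (E × X)} (h : ∀ e e', slice e e' Z = slice e e' W) : Z = W := by
  ext ⟨e, x⟩ ⟨e', x'⟩
  exact congrFun (congrFun (h e e') x) x'

theorem slice_conjTranspose (e e' : E) (Z : Op (E × X)) : slice e e' Zᴴ = (slice e' e Z)ᴴ := rfl

theorem slice_one_kronecker_mul [Fintype E] [DecidableEq E] [Fintype X] (e e' : E) (M : Op X)
    (Z : Op (E × X)) : slice e e' (((1 : Op E) ⊗ₖ M) * Z) = M * slice e e' Z := by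
  ext x x'
  simp [Matrix.mul_apply, Fintype.sum_prod_type, Matrix.one_apply]

theorem slice_mul_one_kronecker [Fintype E] [DecidableEq E] [Fintype X] (e e' : E) (M : Op X)
    (Z : Op (E × X)) : slice e e' (Z * ((1 : Op E) ⊗ₖ M)) = slice e e' Z * M := by
  ext x x'
  simp [Matrix.mul_apply, Fintype.sum_prod_type, Matrix.one_apply]

theorem slice_mul [Fintype E] [Fintype X] (e e' : E) (Z W : Op (E × X)) :
    slice e e' (Z * W) = ∑ k, slice e k Z * slice k e' W := by
  ext x x'
  simp [Matrix.mul_apply, Fintype.sum_prod_type, Matrix.sum_apply]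

theorem slice_one [DecidableEq E] [DecidableEq X] (e e' : E) :
    slice e e' (1 : Op (E × X)) = if e = e' then 1 else 0 := by
  ext x x'
  by_cases h : e = e' <;> simp [h, Matrix.one_apply]

theorem slice_kronecker (e e' : E) (K : Op E) (Z : Op X) :
    slice e e' (K ⊗ₖ Z) = K e e' • Z := by
  ext x x'
  simp

theorem eq_sum_single_kronecker_slice [Fintype E] [DecidableEq E] (Z : Op (E × X)) :
    Z = ∑ e, ∑ e', Matrix.single e e' (1 : ℂ) ⊗ₖ slice e e' Z := by
  ext ⟨c, x⟩ ⟨c', x'⟩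
  simp only [Matrix.sum_apply, Matrix.kroneckerMap_apply, Matrix.single_apply, slice_apply]
  rw [Finset.sum_eq_single c, Finset.sum_eq_single c'] <;> simp +contextual

theorem block_kronecker_one_mul [Fintype E] [DecidableEq E] [Fintype X] (e e' : E) (M : Op X)
    (Z : Op (X × E)) : block e e' ((M ⊗ₖ (1 : Op E)) * Z) = M * block e e' Z := by
  ext x x'
  simp [Matrix.mul_apply, Fintype.sum_prod_type, Matrix.one_apply]

theorem block_mul_kronecker_one [Fintype E] [DecidableEq E] [Fintype X] (e e' : E) (M : Op X)
    (Z : Op (X × E)) : block e e' (Z * (M ⊗ₖ (1 : Op E))) = block e e' Z * M := by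
  ext x x'
  simp [Matrix.mul_apply, Fintype.sum_prod_type, Matrix.one_apply]

theorem block_kronecker (e e' : E) (K : Op X) (L : Op E) : block e e' (K ⊗ₖ L) = L e e' • K := by
  ext x x'
  simp [mul_comm]

theorem eq_sum_block_kronecker_single [Fintype E] [DecidableEq E] (Z : Op (X × E)) :
    Z = ∑ e, ∑ e', block e e' Z ⊗ₖ Matrix.single e e' (1 : ℂ) := by
  ext ⟨x, c⟩ ⟨x', c'⟩
  simp only [Matrix.sum_apply, Matrix.kroneckerMap_apply, Matrix.single_apply, block_apply]
  rw [Finset.sum_eq_single c, Finset.sum_eq_single c'] <;> simp +contextual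

variable [Fintype E] [DecidableEq E] [Fintype F] [DecidableEq F]

theorem tensorId_eq_sum (N : LMap X Y) (Z : Op (X × E)) :
    tensorId E N Z = ∑ e, ∑ e', N (block e e' Z) ⊗ₖ Matrix.single e e' (1 : ℂ) := by
  simp [tensorId, LinearMap.sum_apply]

theorem sum_kronecker_single_apply (G : E → E → Op Y) (y y' : Y) (e e' : E) :
    (∑ c, ∑ c', G c c' ⊗ₖ Matrix.single c c' (1 : ℂ)) (y, e) (y', e') = G e e' y y' := by
  simp only [Matrix.sum_apply, Matrix.kroneckerMap_apply, Matrix.single_apply]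
  rw [Finset.sum_eq_single e, Finset.sum_eq_single e'] <;> simp +contextual

@[simp] theorem block_tensorId (N : LMap X Y) (Z : Op (X × E)) (e e' : E) :
    block e e' (tensorId E N Z) = N (block e e' Z) := by
  ext y y'
  rw [tensorId_eq_sum, block_apply, sum_kronecker_single_apply]

@[simp] theorem tensorId_apply (N : LMap X Y) (Z : Op (X × E)) (y y' : Y) (e e' : E) :
    tensorId E N Z (y, e) (y', e') = N (block e e' Z) y y' := by
  rw [← block_tensorId, block_apply]

theorem tensorId_kronecker (N : LMap X Y) (K : Op X) (L : Op E) :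
    tensorId E N (K ⊗ₖ L) = N K ⊗ₖ L := by
  ext ⟨y, e⟩ ⟨y', e'⟩
  rw [tensorId_apply, block_kronecker, map_smul]
  simp [mul_comm]

@[simp] theorem slice_idTensor (N : LMap X Y) (Z : Op (E × X)) (e e' : E) :
    slice e e' (idTensor E N Z) = N (slice e e' Z) := by
  ext y y'
  simp only [idTensor, slice_apply, LinearMap.comp_apply, relabel_apply]
  exact tensorId_apply N _ y y' e e'

theorem superTensorId_apply (Θ : SMap X Y) (L : LMap (X × E) (X × F)) (Z : Op (Y × E)) (y y' : Y)
    (f f' : F) : superTensorId Θ L Z (y, f) (y', f') =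
      (∑ e, ∑ e', Θ (block f f' ∘ₗ L ∘ₗ embed e e') (block e e' Z)) y y' := by
  have : superTensorId Θ L Z = ∑ c, ∑ c', (∑ e, ∑ e',
      Θ (block c c' ∘ₗ L ∘ₗ embed e e') (block e e' Z)) ⊗ₖ Matrix.single c c' (1 : ℂ) := by
    have h : ∀ c c', (∑ e, ∑ e', Θ (block c c' ∘ₗ L ∘ₗ embed e e') (block e e' Z)) ⊗ₖ
        Matrix.single c c' (1 : ℂ) =
        ∑ e, ∑ e', embed c c' (Θ (block c c' ∘ₗ L ∘ₗ embed e e') (block e e' Z)) := by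
      intro c c'
      rw [← embed_apply]
      simp only [map_sum]
    simp only [superTensorId, LinearMap.sum_apply, LinearMap.comp_apply, h]
    calc _ = ∑ e, ∑ c, ∑ e', ∑ c', embed c c' (Θ (block c c' ∘ₗ L ∘ₗ embed e e') (block e e' Z)) :=
          Finset.sum_congr rfl fun _ _ => Finset.sum_comm
      _ = ∑ c, ∑ e, ∑ e', ∑ c', embed c c' (Θ (block c c' ∘ₗ L ∘ₗ embed e e') (block e e' Z)) :=
          Finset.sum_comm
      _ = ∑ c, ∑ e, ∑ c', ∑ e', embed c c' (Θ (block c c' ∘ₗ L ∘ₗ embed e e') (block e e' Z)) :=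
          Finset.sum_congr rfl fun _ _ => Finset.sum_congr rfl fun _ _ => Finset.sum_comm
      _ = _ := Finset.sum_congr rfl fun _ _ => Finset.sum_comm
  rw [this, sum_kronecker_single_apply]

/-- `Tr_A [U (K ⊗ X) U†]` as a bilinear function of `K` and `X`. -/
def marginal [Fintype A] [Fintype B] (U : Op (A × B)) : Op A →ₗ[ℂ] Op B →ₗ[ℂ] Op B :=
  LinearMap.compr₂ (Matrix.kroneckerBilinear (R := ℂ)) (trFst A B ∘ₗ Ad U)

theorem marginal_apply [Fintype A] [Fintype B] (U : Op (A × B)) (K : Op A) (Z : Op B) :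
    marginal U K Z = trFst A B (Ad U (K ⊗ₖ Z)) := rfl

theorem trFst_eq_sum_slice [Fintype A] (Z : Op (A × B)) : trFst A B Z = ∑ a, slice a a Z := by
  ext b b'
  simp [Matrix.sum_apply]

theorem trace_trFst [Fintype A] [Fintype B] (Z : Op (A × B)) : (trFst A B Z).trace = Z.trace := by
  simp [Matrix.trace, Fintype.sum_prod_type]
  exact Finset.sum_comm

theorem marginal_single [Fintype A] [DecidableEq A] [Fintype B] (U : Op (A × B)) (i j : A)
    (Z : Op B) : marginal U (Matrix.single i j 1) Z =
      ∑ k, slice k i U * Z * (slice k j U)ᴴ := by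
  rw [marginal_apply, trFst_eq_sum_slice]
  refine Finset.sum_congr rfl fun k _ => ?_
  simp only [Ad_apply, slice_mul, slice_kronecker, slice_conjTranspose, Matrix.single_apply,
    ite_smul, one_smul, zero_smul, mul_ite, mul_zero, ite_and]
  rw [Finset.sum_eq_single j]
  · simp
  · intro b _ hb; simp [hb.symm]
  · simp

theorem trFst_Ad_eq_sum [Fintype A] [DecidableEq A] [Fintype B] (U Z : Op (A × B)) :
    trFst A B (Ad U Z) = ∑ a, ∑ a', marginal U (Matrix.single a a' 1) (slice a a' Z) := by
  conv_lhs => rw [eq_sum_single_kronecker_slice Z]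
  simp [marginal_apply]

theorem trFst_Ad_tensorId [Fintype A] [DecidableEq A] [Fintype B] [DecidableEq B]
    (U Z : Op (A × B)) (N : LMap A A) : trFst A B (Ad U (tensorId B N Z)) =
      ∑ a, ∑ a', marginal U (N (Matrix.single a a' 1)) (slice a a' Z) := by
  conv_lhs => rw [eq_sum_single_kronecker_slice Z]
  simp [marginal_apply, tensorId_kronecker]

/-- Expanding σ in matrix units of A and comparing R-blocks removes every tensor product with R,
leaving identities between operators on B. -/
theorem localChange_iff [Fintype A] [DecidableEq A] [Fintype B] [DecidableEq B] [Fintype R]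
    [DecidableEq R] (U σ : Op (A × B)) (N : LMap A (R × A)) (V : Op B) :
    LocalChange U σ N V ↔ ∀ r r',
      ∑ a, ∑ a', marginal U (slice r r' (N (Matrix.single a a' 1))) (slice a a' σ) =
      ∑ a, ∑ a', (slice r r' (N (Matrix.single a a' 1))).trace • Ad V (slice a a' σ) := by
  have hτ : ∀ r r', slice r r' (relabel (Equiv.prodAssoc R A B) (tensorId B N σ)) =
      ∑ a, ∑ a', slice r r' (N (Matrix.single a a' 1)) ⊗ₖ slice a a' σ := by
    intro r r'
    have h : ∀ (K : Op (R × A)) (Z : Op B),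
        slice r r' (relabel (Equiv.prodAssoc R A B) (K ⊗ₖ Z)) = slice r r' K ⊗ₖ Z :=
      fun _ _ => rfl
    conv_lhs => rw [eq_sum_single_kronecker_slice σ]
    simp only [map_sum, tensorId_kronecker, h]
  have htr : ∀ (K : Op A) (Z : Op B), trFst A B (K ⊗ₖ Z) = K.trace • Z := by
    intro K Z
    ext b b'
    simp [Matrix.trace, Finset.sum_mul]
  unfold LocalChange
  constructor
  · intro h r r'
    have := congrArg (slice r r') h
    simpa only [slice_idTensor, hτ, map_sum, htr, map_smul, ← marginal_apply] using this
  · intro h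
    refine ext_slice fun r r' => ?_
    simpa only [slice_idTensor, hτ, map_sum, htr, map_smul, ← marginal_apply] using h r r'

end Slices

/-! ### Spanning by states and effects -/

section Span

variable {X : Type*} [Fintype X] [DecidableEq X] {W : Type*} [AddCommGroup W] [Module ℂ W]

open scoped MatrixOrder Matrix.Norms.L2Operator in
theorem linearMap_ext_posSemidef {f g : Op X →ₗ[ℂ] W} (h : ∀ P : Op X, P.PosSemidef → f P = g P) :
    f = g :=
  LinearMap.ext_on (CStarAlgebra.span_nonneg (A := Op X)) fun P hP =>
    h P (Matrix.nonneg_iff_posSemidef.1 hP)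

theorem linearMap_ext_state {f g : Op X →ₗ[ℂ] W} (h : ∀ ρ : Op X, IsState ρ → f ρ = g ρ) :
    f = g := by
  refine linearMap_ext_posSemidef fun P hP => ?_
  by_cases h0 : P.trace = 0
  · rw [hP.trace_eq_zero_iff.1 h0, map_zero, map_zero]
  · have hs : IsState (P.trace⁻¹ • P) := by
      refine ⟨hP.smul ?_, by simp [h0]⟩
      exact inv_nonneg.2 hP.trace_nonneg
    have := h _ hs
    rw [map_smul, map_smul] at this
    exact smul_right_injective W (inv_ne_zero h0) this

theorem linearMap_ext_single {f g : Op X →ₗ[ℂ] W}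
    (h : ∀ i j, f (Matrix.single i j 1) = g (Matrix.single i j 1)) : f = g := by
  refine LinearMap.ext fun K => ?_
  rw [Matrix.matrix_eq_sum_single K]
  simp only [map_sum]
  refine Finset.sum_congr rfl fun i _ => Finset.sum_congr rfl fun j _ => ?_
  have : Matrix.single i j (K i j) = K i j • Matrix.single i j (1 : ℂ) := by simp
  rw [this, map_smul, map_smul, h]

theorem isState_single (x : X) : IsState (Matrix.single x x (1 : ℂ)) := by
  refine ⟨?_, by simp⟩
  rw [← Matrix.diagonal_single]
  exact Matrix.PosSemidef.diagonal fun y => by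
    by_cases h : y = x
    · subst h; simp
    · simp [h]

open scoped MatrixOrder Matrix.Norms.L2Operator in
/-- A positive multiple of a positive semidefinite operator is an effect. -/
theorem exists_effect {P : Op X} (hP : P.PosSemidef) :
    ∃ c : ℂ, c ≠ 0 ∧ (c • P).PosSemidef ∧ (1 - c • P).PosSemidef := by
  have hle : P ≤ algebraMap ℝ (Op X) ‖P‖ :=
    IsSelfAdjoint.le_algebraMap_norm_self (show IsSelfAdjoint P from hP.isHermitian)
  have h1 : ((‖P‖ : ℂ) • (1 : Op X) - P).PosSemidef := by
    have := Matrix.le_iff.1 hle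
    rwa [Algebra.algebraMap_eq_smul_one, ← Complex.coe_smul] at this
  -- The added 1 keeps the scale invertible when `P = 0`.
  have hc : (0 : ℝ) < ‖P‖ + 1 := by positivity
  have hc' : (0 : ℂ) ≤ ((‖P‖ + 1 : ℝ) : ℂ)⁻¹ := by
    rw [← Complex.ofReal_inv]; exact_mod_cast (inv_pos.2 hc).le
  have hcne : ((‖P‖ + 1 : ℝ) : ℂ) ≠ 0 := by exact_mod_cast hc.ne'
  refine ⟨((‖P‖ + 1 : ℝ) : ℂ)⁻¹, inv_ne_zero hcne, hP.smul hc', ?_⟩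
  have : (1 : Op X) - ((‖P‖ + 1 : ℝ) : ℂ)⁻¹ • P =
      ((‖P‖ + 1 : ℝ) : ℂ)⁻¹ • (((‖P‖ : ℂ) • (1 : Op X) - P) + 1) := by
    have : ((‖P‖ : ℂ) • (1 : Op X) - P) + 1 = ((‖P‖ + 1 : ℝ) : ℂ) • (1 : Op X) - P := by
      push_cast; rw [add_smul, one_smul]; abel
    rw [this, smul_sub, smul_smul, inv_mul_cancel₀ hcne, one_smul]
  rw [this]
  exact (h1.add Matrix.PosSemidef.one).smul hc'

end Span

/-! ### Channels and measure-and-prepare maps -/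

section Channels

variable {X Y Z E : Type*}

theorem tensorId_comp [Fintype E] [DecidableEq E] (M : LMap Y Z) (N : LMap X Y) :
    tensorId E (M ∘ₗ N) = tensorId E M ∘ₗ tensorId E N := by
  ext1 W
  ext ⟨y, e⟩ ⟨y', e'⟩
  simp

/-- The measure-and-prepare map `K ↦ Tr(P K) ρ`. -/
def prep [Fintype X] : Op X →ₗ[ℂ] Op Y →ₗ[ℂ] LMap X Y :=
  LinearMap.mk₂ ℂ (fun P ρ => (Matrix.traceLinearMap X ℂ ℂ ∘ₗ LinearMap.mulLeft ℂ P).smulRight ρ)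
    (fun _ _ _ => by ext1; simp [Matrix.add_mul, add_smul])
    (fun _ _ _ => by ext1; simp [smul_smul])
    (fun _ _ _ => by ext1; simp)
    (fun c _ _ => by ext1; simp [smul_comm c])

theorem prep_apply [Fintype X] (P : Op X) (ρ : Op Y) (K : Op X) :
    prep P ρ K = (P * K).trace • ρ := rfl

variable [Fintype X] [Fintype Y] [Fintype Z]

theorem IsCP.add {M N : LMap X Y} (hM : IsCP M) (hN : IsCP N) : IsCP (M + N) := by
  intro k Z hZ
  have : tensorId (Fin k) (M + N) Z = tensorId (Fin k) M Z + tensorId (Fin k) N Z := by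
    ext ⟨y, e⟩ ⟨y', e'⟩; simp
  rw [this]
  exact (hM k Z hZ).add (hN k Z hZ)

theorem IsChannel.comp {M : LMap Y Z} {N : LMap X Y} (hM : IsChannel M) (hN : IsChannel N) :
    IsChannel (M ∘ₗ N) := by
  refine ⟨fun k P hP => ?_, fun K => (hM.2 _).trans (hN.2 K)⟩
  rw [tensorId_comp]
  exact hM.1 k _ (hN.1 k P hP)

theorem IsChannel.tensorId [Fintype E] [DecidableEq E] {N : LMap X Y} (hN : IsChannel N) :
    IsChannel (tensorId E N) := by
  constructor
  · intro k W hW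
    -- The ancilla E ⊗ ℂ^k is relabelled as one of the standard ancillas over which `IsCP`
    -- quantifies.
    let g := Fintype.equivFin (E × Fin k)
    let W' : Op (X × Fin (Fintype.card (E × Fin k))) :=
      W.submatrix (fun p => ((p.1, (g.symm p.2).1), (g.symm p.2).2))
        (fun p => ((p.1, (g.symm p.2).1), (g.symm p.2).2))
    have h := (hN.1 _ W' (hW.submatrix _)).submatrix
      (fun p : (Y × E) × Fin k => (p.1.1, g (p.1.2, p.2)))
    convert h using 1
    ext ⟨⟨y, e⟩, i⟩ ⟨⟨y', e'⟩, i'⟩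
    simp only [tensorId_apply, Matrix.submatrix_apply]
    have : block e e' (block i i' W) = block (g (e, i)) (g (e', i')) W' := by
      ext x x'
      simp [W']
    rw [this]
  · intro W
    have h : ∀ e : E, ∑ y, N (block e e W) y y = ∑ x, W (x, e) (x, e) := fun e =>
      (hN.2 (block e e W)).trans rfl
    simp only [Matrix.trace, Matrix.diag, Fintype.sum_prod_type, tensorId_apply]
    rw [Finset.sum_comm]
    simp only [h]
    exact Finset.sum_comm

/-- Conjugation `K ↦ W K W†` by a rectangular matrix. -/
def conjMap (W : Matrix Y X ℂ) : LMap X Y where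
  toFun K := W * K * Wᴴ
  map_add' K L := by rw [Matrix.mul_add, Matrix.add_mul]
  map_smul' c K := by rw [Matrix.mul_smul, Matrix.smul_mul, RingHom.id_apply]

theorem isChannel_conjMap [DecidableEq X] {W : Matrix Y X ℂ} (hW : Wᴴ * W = 1) : IsChannel (conjMap W) := by
  constructor
  · intro k P hP
    convert hP.mul_mul_conjTranspose_same (W ⊗ₖ (1 : Op (Fin k))) using 1
    ext ⟨y, e⟩ ⟨y', e'⟩
    simp [conjMap, Matrix.mul_apply, Fintype.sum_prod_type, Matrix.one_apply, apply_ite,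
      Matrix.conjTranspose_apply]
  · intro K
    change (W * K * Wᴴ).trace = K.trace
    rw [Matrix.trace_mul_comm, ← Matrix.mul_assoc, hW, Matrix.one_mul]

theorem posSemidef_trFst [Fintype E] {P : Op (X × E)} (hP : P.PosSemidef) :
    (trFst X E P).PosSemidef := by
  have : trFst X E P = ∑ x, P.submatrix (fun e => (x, e)) (fun e => (x, e)) := by
    ext e e'; simp [Matrix.sum_apply]
  rw [this]
  exact Matrix.posSemidef_sum _ fun x _ => hP.submatrix _

open scoped MatrixOrder Matrix.Norms.L2Operator in
theorem isCP_prep [DecidableEq X] {P : Op X} {ρ : Op Y} (hP : P.PosSemidef) (hρ : ρ.PosSemidef) :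
    IsCP (prep P ρ) := by
  intro k Q hQ
  obtain ⟨F, hF⟩ := CStarAlgebra.nonneg_iff_eq_star_mul_self.1 hP.nonneg
  rw [Matrix.star_eq_conjTranspose] at hF
  suffices h : tensorId (Fin k) (prep P ρ) Q =
      ρ ⊗ₖ trFst X (Fin k) (F ⊗ₖ (1 : Op (Fin k)) * Q * (F ⊗ₖ (1 : Op (Fin k)))ᴴ) by
    rw [h]
    exact hρ.kronecker (posSemidef_trFst (hQ.mul_mul_conjTranspose_same _))
  ext ⟨y, e⟩ ⟨y', e'⟩
  have h2 : trFst X (Fin k) (F ⊗ₖ (1 : Op (Fin k)) * Q * (F ⊗ₖ (1 : Op (Fin k)))ᴴ) e e' =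
      (P * block e e' Q).trace := by
    have : trFst X (Fin k) (F ⊗ₖ (1 : Op (Fin k)) * Q * (F ⊗ₖ (1 : Op (Fin k)))ᴴ) e e' =
        (block e e' (F ⊗ₖ (1 : Op (Fin k)) * Q * (F ⊗ₖ (1 : Op (Fin k)))ᴴ)).trace := rfl
    rw [this, Matrix.conjTranspose_kronecker, Matrix.conjTranspose_one, block_mul_kronecker_one,
      block_kronecker_one_mul, hF, Matrix.trace_mul_comm, Matrix.mul_assoc]
  rw [tensorId_apply, prep_apply, Matrix.kroneckerMap_apply, h2]
  simp [mul_comm]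

theorem isChannel_prep [DecidableEq X] {P : Op X} {ρ₁ ρ₂ : Op Y} (hP : P.PosSemidef) (hP' : (1 - P).PosSemidef)
    (h₁ : IsState ρ₁) (h₂ : IsState ρ₂) : IsChannel (prep P ρ₁ + prep (1 - P) ρ₂) := by
  refine ⟨(isCP_prep hP h₁.1).add (isCP_prep hP' h₂.1), fun K => ?_⟩
  simp [prep_apply, h₁.2, h₂.2]

variable {W : Type*} [AddCommGroup W] [Module ℂ W]

/-- A linear function that is constant on channels vanishes on the maps whose outputs are
traceless. -/
theorem eq_zero_of_const_on_channels [DecidableEq X] [DecidableEq Y] [Nonempty Y] (Φ : LMap X Y →ₗ[ℂ] W)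
    (hΦ : ∀ M N, IsChannel M → IsChannel N → Φ M = Φ N) {N : LMap X Y}
    (hN : ∀ K, (N K).trace = 0) : Φ N = 0 := by
  obtain ⟨y₀⟩ := ‹Nonempty Y›
  set ρ₀ : Op Y := Matrix.single y₀ y₀ 1
  have hρ₀ : IsState ρ₀ := isState_single y₀
  -- Two channels measure the same effect c P and differ only in the state prepared on that outcome.
  -- The common term for 1 - c P cancels.
  have h₁ : ∀ P : Op X, P.PosSemidef → ∀ ρ : Op Y, IsState ρ → Φ (prep P ρ) = Φ (prep P ρ₀) := by
    intro P hP ρ hρ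
    obtain ⟨c, hc, hcP, hcP'⟩ := exists_effect hP
    have h := hΦ _ _ (isChannel_prep hcP hcP' hρ hρ₀) (isChannel_prep hcP hcP' hρ₀ hρ₀)
    rw [map_add, map_add, add_left_inj] at h
    simp only [map_smul, LinearMap.smul_apply] at h
    exact smul_right_injective W hc h
  have h₂ : ∀ P : Op X, P.PosSemidef → ∀ K : Op Y, Φ (prep P K) = K.trace • Φ (prep P ρ₀) := by
    intro P hP K
    have : Φ ∘ₗ prep P = (Matrix.traceLinearMap Y ℂ ℂ).smulRight (Φ (prep P ρ₀)) :=
      linearMap_ext_state fun ρ hρ => by simp [h₁ P hP ρ hρ, hρ.2]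
    exact LinearMap.congr_fun this K
  have h₃ : ∀ (P : Op X) (K : Op Y), K.trace = 0 → Φ (prep P K) = 0 := by
    intro P K hK
    have : Φ ∘ₗ prep.flip K = 0 := linearMap_ext_posSemidef fun P hP => by
      simp [h₂ P hP K, hK]
    exact LinearMap.congr_fun this P
  -- The indices are swapped because Tr(|j⟩⟨i| K) = K_ij.
  have hsum : N = ∑ i, ∑ j, prep (Matrix.single j i 1) (N (Matrix.single i j 1)) := by
    refine linearMap_ext_single fun i j => ?_
    simp only [LinearMap.sum_apply, prep_apply]
    rw [Finset.sum_eq_single i, Finset.sum_eq_single j]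
    · simp
    · intro b _ hb; simp [Matrix.single_mul_single_same, hb, Matrix.trace]
    · simp
    · intro b _ hb
      refine Finset.sum_eq_zero fun c _ => ?_
      rw [Matrix.single_mul_single_of_ne _ _ _ _ hb]; simp
    · simp
  rw [hsum]
  simp only [map_sum]
  exact Finset.sum_eq_zero fun i _ => Finset.sum_eq_zero fun j _ => h₃ _ _ (hN _)

end Channels

/-! ### Input-independent marginals and their unitary form -/

section Main

variable {A B : Type*} [Fintype A] [DecidableEq A] [Fintype B] [DecidableEq B]

/-- The `B`-marginal of `Ad_U (K_{A₀} ⊗ σ_{BA})` is `Tr(K) η_{BA}`; here `η c c'` is the block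
`⟨c| η |c'⟩` with respect to the spectator copy of `A`. -/
def MarginalFree (U σ : Op (A × B)) (η : A → A → Op B) : Prop :=
  ∀ K c c', marginal U K (slice c c' σ) = K.trace • η c c'

theorem sum_slice_conjTranspose_mul {U : Op (A × B)} (hU : U ∈ Matrix.unitaryGroup (A × B) ℂ)
    (i j : A) : ∑ k, (slice k i U)ᴴ * slice k j U = if i = j then 1 else 0 := by
  rw [← slice_one, ← Matrix.mem_unitaryGroup_iff'.1 hU, Matrix.star_eq_conjTranspose, slice_mul]
  rfl

theorem sum_slice_mul_conjTranspose {U : Op (A × B)} (hU : U ∈ Matrix.unitaryGroup (A × B) ℂ)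
    (i j : A) : ∑ k, slice i k U * (slice j k U)ᴴ = if i = j then 1 else 0 := by
  rw [← slice_one, ← Matrix.mem_unitaryGroup_iff.1 hU, Matrix.star_eq_conjTranspose, slice_mul]
  rfl

/-- The blocks of σ need not be positive separately, so rigidity is applied to the whole of σ and to
the unitary U extended by the identity on the spectator A. The resulting relation is then read off
block by block. -/
theorem MarginalFree.intertwines {U : Op (A × B)} (hU : U ∈ Matrix.unitaryGroup (A × B) ℂ)
    {σ : Op (A × B)} (hσ : σ.PosSemidef) {η : A → A → Op B} (h : MarginalFree U σ η)
    (k i c c' : A) : slice k i U * slice c c' σ = η c c' * slice k i U := by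
  have hk : ∀ M N : Op B, ((1 : Op A) ⊗ₖ M) * ((1 : Op A) ⊗ₖ N) = (1 : Op A) ⊗ₖ (M * N) := by
    intro M N
    rw [← Matrix.mul_kronecker_mul, Matrix.one_mul]
  have hc : ∀ M : Op B, ((1 : Op A) ⊗ₖ M)ᴴ = (1 : Op A) ⊗ₖ Mᴴ := by
    intro M
    rw [Matrix.conjTranspose_kronecker, Matrix.conjTranspose_one]
  have hs : ∀ f : A → Op B, ∑ k, (1 : Op A) ⊗ₖ f k = (1 : Op A) ⊗ₖ ∑ k, f k := fun f =>
    (map_sum (Matrix.kroneckerBilinear (R := ℂ) (1 : Op A)) f Finset.univ).symm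
  have hif : ∀ i j : A, (1 : Op A) ⊗ₖ (if i = j then (1 : Op B) else 0) =
      if i = j then (1 : Op (A × B)) else 0 := by
    intro i j; split_ifs <;> simp
  let H : Op (A × B) := Matrix.of fun p q => η p.1 q.1 p.2 q.2
  have hH : ∀ c c', slice c c' H = η c c' := fun _ _ => rfl
  have key := intertwines_of_marginal (P := fun k i => (1 : Op A) ⊗ₖ slice k i U) (X := σ) (η := H)
    (fun i j => by simp only [hc, hk, hs, sum_slice_conjTranspose_mul hU, hif])
    (fun i j => by simp only [hc, hk, hs, sum_slice_mul_conjTranspose hU, hif]) hσ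
    (fun i j => ext_slice fun c c' => by
      simp only [map_sum, hc, slice_mul_one_kronecker, slice_one_kronecker_mul]
      rw [← marginal_single, h]
      by_cases hij : i = j
      · subst hij; simp [hH]
      · simp [hij, Matrix.trace_single_eq_of_ne]) k i
  have := congrArg (slice c c') key
  rwa [slice_one_kronecker_mul, slice_mul_one_kronecker] at this

/-- If the marginal does not depend on the input, then the change of `σ` is unitary on `B`. -/
theorem MarginalFree.exists_unitary [Nonempty A] {U : Op (A × B)}
    (hU : U ∈ Matrix.unitaryGroup (A × B) ℂ) {σ : Op (A × B)} (hσ : σ.PosSemidef)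
    {η : A → A → Op B} (h : MarginalFree U σ η) :
    ∃ V ∈ Matrix.unitaryGroup B ℂ, MarginalFree U σ fun c c' => Ad V (slice c c' σ) := by
  have hσ' : ∀ p : A × A, (slice p.1 p.2 σ)ᴴ = slice p.2 p.1 σ := by
    intro p
    rw [← slice_conjTranspose, hσ.isHermitian]
  have hη : ∀ p : A × A, (η p.1 p.2)ᴴ = η p.2 p.1 := by
    intro p
    obtain ⟨i⟩ := ‹Nonempty A›
    have e : ∀ c c', η c c' = ∑ k, slice k i U * slice c c' σ * (slice k i U)ᴴ := by
      intro c c'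
      rw [← marginal_single, h]; simp
    rw [e, e, Matrix.conjTranspose_sum]
    simp only [Matrix.conjTranspose_mul, Matrix.conjTranspose_conjTranspose, hσ', Matrix.mul_assoc]
  -- The families are indexed by pairs (c, c'), and taking adjoints swaps the pair.
  obtain ⟨V, hV, hVint⟩ := exists_unitary_intertwiner (J := A × A) (s := Prod.swap)
    (x := fun p => slice p.1 p.2 σ) (y := fun p => η p.1 p.2) (sum_slice_conjTranspose_mul hU)
    hσ' hη (fun _ => rfl) (fun k i p => h.intertwines hU hσ k i p.1 p.2)
  refine ⟨V, hV, fun K c c' => ?_⟩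
  have : Ad V (slice c c' σ) = η c c' := by
    rw [Ad_apply, hVint (c, c'), Matrix.mul_assoc, ← Matrix.star_eq_conjTranspose,
      Matrix.mem_unitaryGroup_iff.1 hV, Matrix.mul_one]
  exact (h K c c').trans (congrArg _ this.symm)

theorem MarginalFree.semBUniform {U σ : Op (A × B)} {V : Op B}
    (hV : V ∈ Matrix.unitaryGroup B ℂ) (h : MarginalFree U σ fun c c' => Ad V (slice c c' σ)) :
    SemBUniform U σ := by
  refine ⟨V, hV, fun R _ _ N _ => (localChange_iff U σ N V).2 fun r r' => ?_⟩
  simp only [h _ _ _]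

/-- Tests with half of a maximally entangled state. -/
theorem SemB.marginalFree [Nonempty A] {U σ : Op (A × B)} (h : SemB U σ) :
    ∃ η, MarginalFree U σ η := by
  let n := Fintype.card A
  let e : A ≃ Fin n := Fintype.equivFin A
  have hn : (0 : ℝ) < n := by exact_mod_cast Fintype.card_pos
  let t : ℂ := ((Real.sqrt n)⁻¹ : ℝ)
  have ht : t * t = (n : ℂ)⁻¹ := by
    simp only [t]
    rw [← Complex.ofReal_mul, ← mul_inv, Real.mul_self_sqrt hn.le]; simp
  have hts : star t = t := Complex.conj_ofReal _
  have hn' : (n : ℂ) ≠ 0 := by exact_mod_cast hn.ne'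
  -- This isometry stores the input in the first register and prepares a maximally entangled state,
  -- of amplitude 1/√n, between the second register and the new A.
  let W : Matrix ((Fin n × Fin n) × A) A ℂ :=
    Matrix.of fun p a => if e.symm p.1.1 = a then if e.symm p.1.2 = p.2 then t else 0 else 0
  have hW : Wᴴ * W = 1 := by
    ext a a'
    simp only [Matrix.mul_apply, Matrix.conjTranspose_apply, Fintype.sum_prod_type, W,
      Matrix.of_apply, apply_ite star, star_zero, hts, Matrix.one_apply]
    rw [← e.sum_comp]
    simp only [e.symm_apply_apply]
    rw [Finset.sum_eq_single a]
    · by_cases haa : a = a'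
      · subst haa; simp [ht, hn']
      · simp [haa]
    · intro b _ hb; simp [hb]
    · simp
  obtain ⟨V, -, hloc⟩ := h (Fin n × Fin n) (conjMap W) (isChannel_conjMap hW)
  rw [localChange_iff] at hloc
  have hN : ∀ i j c c' a a', slice (e c, e i) (e c', e j) (conjMap W (Matrix.single a a' 1)) =
      if a = c then if a' = c' then (n : ℂ)⁻¹ • Matrix.single i j (1 : ℂ) else 0 else 0 := by
    intro i j c c' a a'
    have : conjMap W (Matrix.single a a' 1) =
        Matrix.of fun p q => W p a * star (W q a') := by
      ext p q
      simp only [conjMap, LinearMap.coe_mk, AddHom.coe_mk, Matrix.mul_apply, Matrix.single_apply,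
        Matrix.conjTranspose_apply, Matrix.of_apply]
      rw [Finset.sum_eq_single a']
      · rw [Finset.sum_eq_single a] <;> simp +contextual [eq_comm]
      · intro b _ hb; simp [hb.symm]
      · simp
    ext x x'
    rw [this]
    simp only [slice_apply, Matrix.of_apply, W, e.symm_apply_apply]
    by_cases h1 : c = a <;> by_cases h2 : c' = a' <;> by_cases h3 : i = x <;>
      by_cases h4 : j = x' <;> simp [h1, h2, h3, h4, hts, ht, eq_comm]
  refine ⟨fun c c' => Ad V (slice c c' σ), fun K c c' => ?_⟩
  have : (marginal U).flip (slice c c' σ) =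
      (Matrix.traceLinearMap A ℂ ℂ).smulRight (Ad V (slice c c' σ)) := by
    refine linearMap_ext_single fun i j => ?_
    -- This block of R isolates K = |i⟩⟨j| and σ_{cc'}, both sides carrying the factor 1/n.
    have := hloc (e c, e i) (e c', e j)
    simp only [hN] at this
    rw [Finset.sum_eq_single c, Finset.sum_eq_single c', Finset.sum_eq_single c,
      Finset.sum_eq_single c'] at this
    · simp only [if_true, map_smul, LinearMap.smul_apply, Matrix.trace_smul, smul_assoc] at this
      exact smul_right_injective _ (inv_ne_zero hn') this
    all_goals first | (simp; done) | (intro b _ hb; simp [hb])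
  exact LinearMap.congr_fun this K

end Main

/-! ### Delocalized catalysts -/

section Catalysis

variable {A B A₁ : Type*} [Fintype A] [DecidableEq A] [Fintype B] [Fintype A₁] [DecidableEq A₁]

theorem catalystOutput_kronecker (U : Op (A × B)) (K : Op A) (L : Op A₁) (M : Op B) (N : Op A) :
    catalystOutput U (1 : Op (A₁ × A)) (K ⊗ₖ L) (M ⊗ₖ N) = L.trace • (marginal U K M ⊗ₖ N) := by
  let e := Equiv.prodProdProdComm A B A₁ A
  have h₁ : (K ⊗ₖ L) ⊗ₖ (M ⊗ₖ N) = relabel e ((K ⊗ₖ M) ⊗ₖ (L ⊗ₖ N)) := by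
    ext ⟨⟨a, a₁⟩, b, c⟩ ⟨⟨a', a₁'⟩, b', c'⟩
    simp [e, mul_mul_mul_comm]
  have hm : ∀ Z W : Op ((A × B) × (A₁ × A)), relabel e Z * relabel e W = relabel e (Z * W) :=
    fun Z W => Matrix.submatrix_mul_equiv _ _ _ _ _
  have hc : ∀ Z : Op ((A × B) × (A₁ × A)), (relabel e Z)ᴴ = relabel e Zᴴ := fun Z => rfl
  have h₂ : Ad (relabel e (U ⊗ₖ (1 : Op (A₁ × A)))) (relabel e ((K ⊗ₖ M) ⊗ₖ (L ⊗ₖ N))) =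
      relabel e (Ad U (K ⊗ₖ M) ⊗ₖ (L ⊗ₖ N)) := by
    rw [Ad_apply, hc, hm, hm, Matrix.conjTranspose_kronecker, Matrix.conjTranspose_one,
      ← Matrix.mul_kronecker_mul, ← Matrix.mul_kronecker_mul, Matrix.one_mul, Matrix.mul_one,
      Ad_apply]
  rw [catalystOutput, h₁, h₂, marginal_apply]
  ext ⟨b, c⟩ ⟨b', c'⟩
  simp only [trFst_apply, Fintype.sum_prod_type, relabel_apply, e, Equiv.prodProdProdComm_symm,
    Equiv.prodProdProdComm_apply, Matrix.kroneckerMap_apply, Matrix.smul_apply, smul_eq_mul,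
    Matrix.trace, Matrix.diag]
  rw [Finset.sum_comm, Finset.sum_mul]
  refine Finset.sum_congr rfl fun i _ => ?_
  rw [Finset.sum_mul, Finset.mul_sum]
  refine Finset.sum_congr rfl fun j _ => ?_
  ring

/-- Nothing acts on A₁ or on the spectator A, so ρ enters only through its marginal on A₀, and the
blocks of σ are transformed one at a time. -/
theorem catalystOutput_eq_sum (U σ : Op (A × B)) (ρ : Op (A × A₁)) :
    catalystOutput U (1 : Op (A₁ × A)) ρ (relabel (Equiv.prodComm A B) σ) =
      ∑ c, ∑ c', marginal U (∑ i, ∑ j, (slice i j ρ).trace • Matrix.single i j (1 : ℂ))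
        (slice c c' σ) ⊗ₖ Matrix.single c c' (1 : ℂ) := by
  have hbil : ∀ (ρ : Op (A × A₁)) (τ : Op (B × A)), catalystOutput U (1 : Op (A₁ × A)) ρ τ =
      (Matrix.kroneckerBilinear (R := ℂ)).compr₂ (trFst (A × A₁) (B × A) ∘ₗ
        Ad (relabel (Equiv.prodProdProdComm A B A₁ A) (U ⊗ₖ (1 : Op (A₁ × A))))) ρ τ :=
    fun _ _ => rfl
  have hσ : relabel (Equiv.prodComm A B) σ =
      ∑ c, ∑ c', slice c c' σ ⊗ₖ Matrix.single c c' (1 : ℂ) :=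
    eq_sum_block_kronecker_single (relabel (Equiv.prodComm A B) σ)
  have hk : ∀ (M : Op B) (L : Op A), M ⊗ₖ L = Matrix.kroneckerBilinear (R := ℂ) M L :=
    fun _ _ => rfl
  rw [hbil, hσ]
  conv_lhs => rw [eq_sum_single_kronecker_slice ρ]
  simp only [map_sum, LinearMap.sum_apply]
  simp only [← hbil, catalystOutput_kronecker]
  refine Finset.sum_congr rfl fun c _ => Finset.sum_congr rfl fun c' _ => ?_
  simp only [hk, map_sum, LinearMap.sum_apply, map_smul, LinearMap.smul_apply]

theorem MarginalFree.semCOnB [DecidableEq B] {U σ : Op (A × B)} {V : Op B} (hV : V ∈ Matrix.unitaryGroup B ℂ)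
    (h : MarginalFree U σ fun c c' => Ad V (slice c c' σ)) : SemCOnB A₁ U σ := by
  refine ⟨V, hV, fun ρ hρ => ?_⟩
  have htr : (∑ i, ∑ j, (slice i j ρ).trace • Matrix.single i j (1 : ℂ)).trace = 1 := by
    refine Eq.trans ?_ hρ.2
    simp only [Matrix.trace_sum, Matrix.trace_smul]
    simp only [Matrix.trace, Fintype.sum_prod_type]
    refine Finset.sum_congr rfl fun i _ => ?_
    rw [Finset.sum_eq_single i]
    · simp
    · intro b _ hb; simp [hb.symm]
    · simp
  have hσ : relabel (Equiv.prodComm A B) σ =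
      ∑ c, ∑ c', slice c c' σ ⊗ₖ Matrix.single c c' (1 : ℂ) :=
    eq_sum_block_kronecker_single (relabel (Equiv.prodComm A B) σ)
  rw [catalystOutput_eq_sum, hσ]
  generalize (∑ i, ∑ j, (slice i j ρ).trace • Matrix.single i j (1 : ℂ)) = κ at htr ⊢
  simp only [h _ _ _, htr, one_smul, map_sum]
  refine Finset.sum_congr rfl fun c _ => Finset.sum_congr rfl fun c' _ => ?_
  rw [Ad_apply, Ad_apply, Matrix.conjTranspose_kronecker, Matrix.conjTranspose_one,
    ← Matrix.mul_kronecker_mul, ← Matrix.mul_kronecker_mul, Matrix.one_mul, Matrix.mul_one]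

theorem SemCOnB.semC [DecidableEq B] {U σ : Op (A × B)} (h : SemCOnB A₁ U σ) : SemC A₁ U σ :=
  let ⟨V, hV, hc⟩ := h
  ⟨V, hV, 1, one_mem _, hc⟩

/-- What matters is that the right-hand side does not depend on ρ: its blocks serve as η, and
product inputs realize every state of A₀. -/
theorem SemC.marginalFree [DecidableEq B] [Nonempty A₁] {U σ : Op (A × B)} (h : SemC A₁ U σ) :
    ∃ η, MarginalFree U σ η := by
  obtain ⟨V₀, -, V₁, -, hc⟩ := h
  obtain ⟨a₁⟩ := ‹Nonempty A₁›
  refine ⟨fun c c' => block c c' (Ad (V₀ ⊗ₖ V₁) (relabel (Equiv.prodComm A B) σ)),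
    fun K c c' => ?_⟩
  have : (marginal U).flip (slice c c' σ) = (Matrix.traceLinearMap A ℂ ℂ).smulRight
      (block c c' (Ad (V₀ ⊗ₖ V₁) (relabel (Equiv.prodComm A B) σ))) := by
    refine linearMap_ext_state fun ρ hρ => ?_
    have hs : IsState (ρ ⊗ₖ Matrix.single a₁ a₁ (1 : ℂ)) :=
      ⟨hρ.1.kronecker (isState_single a₁).1, by simp [Matrix.trace_kronecker, hρ.2]⟩
    have h := hc _ hs
    rw [catalystOutput_eq_sum] at h
    have hρ' : ∑ i, ∑ j, (slice i j (ρ ⊗ₖ Matrix.single a₁ a₁ (1 : ℂ))).trace •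
        Matrix.single i j (1 : ℂ) = ρ := by
      conv_rhs => rw [Matrix.matrix_eq_sum_single ρ]
      refine Finset.sum_congr rfl fun i _ => Finset.sum_congr rfl fun j _ => ?_
      rw [slice_kronecker]; simp
    rw [hρ'] at h
    have h' := congrArg (block c c') h
    simp only [LinearMap.flip_apply, LinearMap.smulRight_apply, Matrix.traceLinearMap_apply, hρ.2,
      one_smul]
    rw [← h']
    ext b b'
    rw [block_apply, sum_kronecker_single_apply]
  exact LinearMap.congr_fun this K

end Catalysis

/-! ### Superchannels -/

section Superchannels

theorem superTensorId_lcomp {A E F : Type*} [Fintype E] [DecidableEq E] [Fintype F] [DecidableEq F]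
    (N : LMap A A) (L : LMap (A × E) (A × F)) :
    superTensorId (LinearMap.lcomp ℂ (Op A) N) L = L ∘ₗ tensorId E N := by
  ext1 Z
  ext ⟨y, f⟩ ⟨y', f'⟩
  rw [superTensorId_apply, LinearMap.comp_apply, tensorId_eq_sum]
  simp [Matrix.sum_apply]

variable {A B : Type*} [Fintype A] [DecidableEq A] [Fintype B] [DecidableEq B]

/-- Preprocessing by a channel is a superchannel. -/
theorem isSuperchannel_lcomp {A : Type*} [Fintype A] {N : LMap A A} (hN : IsChannel N) :
    IsSuperchannel (LinearMap.lcomp ℂ (Op A) N) := by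
  intro E F _ _ _ _ L hL
  rw [superTensorId_lcomp]
  exact hL.comp hN.tensorId

/-- Preprocessing channels suffice as tests: the marginal is linear in the channel, so constancy on
channels makes it vanish on maps with traceless outputs. -/
theorem SemA.marginalFree [Nonempty A] {U σ : Op (A × B)} (h : SemA U σ) :
    ∃ η, MarginalFree U σ η := by
  obtain ⟨η, -, h⟩ := h
  let Φ : LMap A A →ₗ[ℂ] Op B :=
    { toFun := fun N => ∑ a, ∑ a', marginal U (N (Matrix.single a a' 1)) (slice a a' σ)
      map_add' := fun M N => by simp [Finset.sum_add_distrib]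
      map_smul' := fun c N => by simp [Finset.smul_sum] }
  have hΦ : ∀ N, IsChannel N → Φ N = η := fun N hN => by
    rw [← h _ (isSuperchannel_lcomp hN), superTensorId_lcomp]
    exact (trFst_Ad_tensorId U σ N).symm
  have h0 : ∀ K : Op A, K.trace = 0 → ∀ c c', marginal U K (slice c c' σ) = 0 := by
    intro K hK c c'
    -- The map L ↦ L_{cc'} K picks out the block σ_{cc'} and replaces it by K ⊗ σ_{cc'}.
    have h1 := eq_zero_of_const_on_channels Φ
      (fun M N hM hN => (hΦ M hM).trans (hΦ N hN).symm) (N := prep (Matrix.single c' c 1) K)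
      (fun L => by simp [prep_apply, hK])
    rw [← h1]
    change _ = ∑ a, ∑ a', _
    simp only [prep_apply, map_smul, LinearMap.smul_apply]
    rw [Finset.sum_eq_single c, Finset.sum_eq_single c']
    · simp
    · intro b _ hb; simp [Matrix.trace_single_eq_of_ne, hb.symm]
    · simp
    · intro b _ hb
      refine Finset.sum_eq_zero fun b' _ => ?_
      rw [Matrix.single_mul_single_of_ne _ _ _ _ hb.symm]; simp
    · simp
  have hA : (Fintype.card A : ℂ) ≠ 0 := by exact_mod_cast Fintype.card_ne_zero
  refine ⟨fun c c' => (Fintype.card A : ℂ)⁻¹ • marginal U 1 (slice c c' σ), fun K c c' => ?_⟩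
  -- Subtracting from K its trace part, a multiple of the identity, leaves a traceless operator.
  have := h0 (K - (K.trace * (Fintype.card A : ℂ)⁻¹) • 1) (by simp [hA]) c c'
  rwa [map_sub, LinearMap.sub_apply, sub_eq_zero, map_smul, LinearMap.smul_apply,
    mul_smul] at this

/-- A superchannel takes maps that scale the trace by `c` to maps that scale the trace by `c`. -/
theorem IsSuperchannel.trace_apply [Nonempty A] {Θ : SMap A A} (hΘ : IsSuperchannel Θ)
    {N : LMap A A} {c : ℂ} (hN : ∀ K, (N K).trace = c * K.trace) (K : Op A) :
    (Θ N K).trace = c * K.trace := by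
  have hch : ∀ M, IsChannel M → (Θ M K).trace = K.trace := by
    intro M hM
    -- One-dimensional E and F turn the definition into a statement about Θ alone.
    have h := (hΘ Unit Unit (tensorId Unit M) hM.tensorId).2 (K ⊗ₖ Matrix.single () () 1)
    have hM' : block () () ∘ₗ tensorId Unit M ∘ₗ embed () () = M := by
      ext1 L
      simp [block_kronecker]
    have e : ∀ Z : Op (A × Unit), Z.trace = (block () () Z).trace := fun Z => by
      simp [Matrix.trace, Fintype.sum_prod_type]
    have e' : block () () (superTensorId Θ (tensorId Unit M) (K ⊗ₖ Matrix.single () () 1)) =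
        Θ M K := by
      ext y y'
      rw [block_apply, superTensorId_apply]
      simp [hM', block_kronecker]
    rw [e, e', Matrix.trace_kronecker] at h
    simpa using h
  let Φ : LMap A A →ₗ[ℂ] ℂ := Matrix.traceLinearMap A ℂ ℂ ∘ₗ LinearMap.applyₗ K ∘ₗ Θ
  have hΦ : ∀ M, Φ M = (Θ M K).trace := fun _ => rfl
  have hid : IsChannel (LinearMap.id : LMap A A) := by
    refine ⟨fun k Z hZ => ?_, fun _ => rfl⟩
    convert hZ using 1
    ext ⟨y, e⟩ ⟨y', e'⟩
    simp
  -- N - c·id has traceless outputs, so Θ(N) and c Θ(id) give K the same trace; and Θ(id) preserves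
  -- the trace since id is a channel.
  have h0 := eq_zero_of_const_on_channels Φ
    (fun M N hM hN => (hch M hM).trans (hch N hN).symm) (N := N - c • LinearMap.id)
    (fun L => by simp [hN])
  rw [map_sub, map_smul, sub_eq_zero, hΦ, hΦ, hch _ hid] at h0
  exact h0

theorem isState_trFst_Ad {U σ : Op (A × B)} (hU : U ∈ Matrix.unitaryGroup (A × B) ℂ)
    (hσ : IsState σ) : IsState (trFst A B (Ad U σ)) := by
  refine ⟨posSemidef_trFst (hσ.1.mul_mul_conjTranspose_same U), ?_⟩
  rw [trace_trFst, Ad_apply, Matrix.trace_mul_comm, ← Matrix.mul_assoc,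
    ← Matrix.star_eq_conjTranspose, Matrix.mem_unitaryGroup_iff'.1 hU, Matrix.one_mul, hσ.2]

theorem MarginalFree.semA [Nonempty A] {U σ : Op (A × B)} {η : A → A → Op B}
    (hU : U ∈ Matrix.unitaryGroup (A × B) ℂ) (hσ : IsState σ) (h : MarginalFree U σ η) :
    SemA U σ := by
  have htot : trFst A B (Ad U σ) = ∑ c, η c c := by
    rw [trFst_Ad_eq_sum]
    refine Finset.sum_congr rfl fun c _ => ?_
    rw [Finset.sum_eq_single c]
    · rw [h]; simp
    · intro b _ hb; rw [h]; simp [Matrix.trace_single_eq_of_ne, hb.symm]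
    · simp
  refine ⟨trFst A B (Ad U σ), isState_trFst_Ad hU hσ, fun Θ hΘ => ?_⟩
  rw [htot]
  ext f f'
  let G : B → B → LMap A A := fun e e' => block f f' ∘ₗ Ad U ∘ₗ embed e e'
  -- The map K ↦ ⟨f| U (K ⊗ σ_{cc'}) U† |f'⟩ on A. `MarginalFree` says that it scales the trace by
  -- the (f, f') entry of η_{cc'}, so its image under Θ does as well.
  let M : A → A → LMap A A := fun c c' => ∑ e, ∑ e', σ (c, e) (c', e') • G e e'
  have hM : ∀ c c' K, M c c' K = block f f' (Ad U (K ⊗ₖ slice c c' σ)) := by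
    intro c c' K
    have hk : ∀ L : Op B, K ⊗ₖ L = Matrix.kroneckerBilinear (R := ℂ) K L := fun _ => rfl
    conv_rhs => rw [Matrix.matrix_eq_sum_single (slice c c' σ)]
    have : ∀ e e', Matrix.single e e' (slice c c' σ e e') =
        σ (c, e) (c', e') • Matrix.single e e' (1 : ℂ) := by intro e e'; simp
    simp only [this, hk, map_sum, map_smul]
    simp [M, G, LinearMap.sum_apply, hk]
  have hMtr : ∀ c c' K, (M c c' K).trace = η c c' f f' * K.trace := by
    intro c c' K
    have := congrFun (congrFun (h K c c') f) f'
    rw [hM, mul_comm]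
    exact this
  have hblock : ∀ e e', block e e' σ = ∑ c, ∑ c', σ (c, e) (c', e') • Matrix.single c c' (1 : ℂ) := by
    intro e e'
    conv_lhs => rw [Matrix.matrix_eq_sum_single (block e e' σ)]
    simp
  calc trFst A B (superTensorId Θ (Ad U) σ) f f'
      = (∑ e, ∑ e', Θ (G e e') (block e e' σ)).trace := by
        simp only [trFst_apply, superTensorId_apply]; rfl
    _ = (∑ c, ∑ c', Θ (M c c') (Matrix.single c c' 1)).trace := by
        congr 1
        simp only [hblock, M, map_sum, map_smul, LinearMap.sum_apply, LinearMap.smul_apply]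
        calc _ = ∑ e, ∑ c, ∑ e', ∑ c', σ (c, e) (c', e') • Θ (G e e') (Matrix.single c c' 1) :=
              Finset.sum_congr rfl fun _ _ => Finset.sum_comm
          _ = ∑ c, ∑ e, ∑ e', ∑ c', σ (c, e) (c', e') • Θ (G e e') (Matrix.single c c' 1) :=
              Finset.sum_comm
          _ = ∑ c, ∑ e, ∑ c', ∑ e', σ (c, e) (c', e') • Θ (G e e') (Matrix.single c c' 1) :=
              Finset.sum_congr rfl fun _ _ => Finset.sum_congr rfl fun _ _ => Finset.sum_comm
          _ = _ := Finset.sum_congr rfl fun _ _ => Finset.sum_comm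
    _ = ∑ c, ∑ c', η c c' f f' * (Matrix.single c c' (1 : ℂ)).trace := by
        simp only [Matrix.trace_sum, hΘ.trace_apply (hMtr _ _)]
    _ = (∑ c, η c c) f f' := by
        rw [Matrix.sum_apply]
        refine Finset.sum_congr rfl fun c _ => ?_
        rw [Finset.sum_eq_single c]
        · simp
        · intro b _ hb; simp [Matrix.trace_single_eq_of_ne, hb.symm]
        · simp

end Superchannels

end QInfo

end

theorem mainTheorem3 {A B A₁ : Type*} [Fintype A] [DecidableEq A] [Fintype B] [DecidableEq B]
    [Fintype A₁] [DecidableEq A₁] [Nonempty A₁]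
    (U : Matrix (A × B) (A × B) ℂ) (hU : U ∈ Matrix.unitaryGroup (A × B) ℂ)
    (σ : Matrix (A × B) (A × B) ℂ) (hσ : QInfo.IsState σ) :
    [QInfo.SemA U σ, QInfo.SemB U σ, QInfo.SemBUniform U σ,
      QInfo.SemC A₁ U σ, QInfo.SemCOnB A₁ U σ].TFAE := by
  -- On an empty A the trace of σ would be 0, not 1.
  have : Nonempty A := by
    by_contra hA
    have := not_nonempty_iff.1 hA
    simpa [Matrix.trace] using hσ.2
  have key : ∀ η, QInfo.MarginalFree U σ η → ∃ V ∈ Matrix.unitaryGroup B ℂ,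
      QInfo.MarginalFree U σ fun c c' => QInfo.Ad V (QInfo.slice c c' σ) :=
    fun η h => h.exists_unitary hU hσ.1
  tfae_have 1 → 3 := fun h => by
    obtain ⟨η, hη⟩ := h.marginalFree
    obtain ⟨V, hV, hf⟩ := key η hη
    exact hf.semBUniform hV
  tfae_have 3 → 2 := fun ⟨V, hV, h⟩ R _ _ N hN => ⟨V, hV, h R N hN⟩
  tfae_have 2 → 5 := fun h => by
    obtain ⟨η, hη⟩ := h.marginalFree
    obtain ⟨V, hV, hf⟩ := key η hη
    exact hf.semCOnB hV
  tfae_have 5 → 4 := fun h => h.semC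
  tfae_have 4 → 1 := fun h => by
    obtain ⟨η, hη⟩ := h.marginalFree
    exact hη.semA hU hσ
  tfae_finish
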